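/- Let $-\infty<\delta_1<\delta_2<\infty$, let $m\ge 1$ and let $\mathcal Y_m\subset(\delta_1,\delta_2)$ be a (fixed) set of $m$ distinct points $y_{(1)}<\dots<y_{(m)}$; put $y_{(0)}=\delta_1$, $y_{(m+1)}=\delta_2$ and $w_i=(y_{(i)}-y_{(i-1)})/(\delta_2-\delta_1)$ for $i=1,\dots,m+1$. Let $\tau\in(0,\infty)$ and $c\in(0,1)$. *Proximity regions.* For a point $x$ of a middle interval $(a,b)=(y_{(i-1)},y_{(i)})$, $2\le i\le m$, with $M_c=a+c(b-a)$, let $$N(x,\tau,c)=\begin{cases}\left(x-\tau(x-a),\,x+\frac{\tau(1-c)(x-a)}{c}\right)\cap(a,b), & x<M_c,\\[2pt] \left(x-\frac{c\tau(b-x)}{1-c},\,x+\tau(b-x)\right)\cap(a,b), & x\ge M_c;\end{cases}$$ for a point $x$ of an end interval let $N_e(x,\tau)=(x-\tau(y_{(1)}-x),x+\tau(y_{(1)}-x))\cap(-\infty,y_{(1)})$ if $x<y_{(1)}$ and $N_e(x,\tau)=(x-\tau(x-y_{(m)}),x+\tau(x-y_{(m)}))\cap(y_{(m)},\infty)$ if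 $x>y_{(m)}$; the region of $x\in\mathcal Y_m$ is $\{x\}$. Let $X_1,X_2,\dots$ be independent and uniformly distributed on $(\delta_1,\delta_2)$. Let $\mathcal A$ be the set of the pairs $(X_i,X_j)$, $1\le i\ne j\le n$, such that $X_j$ lies in the proximity region of $X_i$, and let $\widetilde\rho_{n,m}(\tau,c)=|\mathcal A|/(n(n-1))$ (and $0$ for $n\le 1$). *Constants.* Let $\mu(\tau,c)=\mu_1(\tau,c)$ for $0<c\le 1/2$ and $\mu(\tau,c)=\mu_1(\tau,1-c)$ for $1/2<c<1$, where $$\mu_1(\tau,c)=\begin{cases}\tau/2, & 0<\tau<1,\\ \dfrac{\tau(1+2c(\tau-1)(1-c))}{2(c\tau-c+1)(\tau+c-c\tau)}, & \tau\ge1,\end{cases}\qquad \mu_e(\tau)=\begin{cases}\dfrac{\tau(\tau+2)}{2(\tau+1)}, & 0<\tau<1,\\[4pt] \dfrac{1+2\tau}{2(\tau+1)}, & \tau\ge1.\end{cases}$$ For a map $N$ that assigns to each point a region, write $\Gamma_1(x,N)=\{z: x\in N(z)\}$ and, for $U_1,U_2,U_3$ independent and uniform on $(0,1)$, $$P_{2N}=P(\{U_2,U_3\}\subset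 N(U_1)),\quad P_{NG}=P(U_2\in N(U_1),\,U_3\in\Gamma_1(U_1,N)),\quad P_{2G}=P(\{U_2,U_3\}\subset\Gamma_1(U_1,N)),$$ with $N=N(\cdot,\tau,c)$ for the middle interval $(a,b)=(0,1)$; let $P_{2N,e},P_{NG,e},P_{2G,e}$ be the same probabilities with $N=N_e(\cdot,\tau)$ for the right end interval, taken as $(0,1)$ with $0$ as its $\mathcal Y$-point. Put $$\widetilde\mu(m,\tau,c)=\mu(\tau,c)\sum_{i=2}^m w_i^2+\mu_e(\tau)\sum_{i\in\{1,m+1\}}w_i^2,$$ $$4\,\widetilde\nu(m,\tau,c)=[P_{2N}+2P_{NG}+P_{2G}]\sum_{i=2}^m w_i^3+[P_{2N,e}+2P_{NG,e}+P_{2G,e}]\sum_{i\in\{1,m+1\}}w_i^3-4\,\widetilde\mu(m,\tau,c)^2.$$ **Theorem.** If $\widetilde\nu(m,\tau,c)>0$, then $$\sqrt n\,\bigl(\widetilde\rho_{n,m}(\tau,c)-\widetilde\mu(m,\tau,c)\bigr)\xrightarrow{\ \mathcal L\ }\mathcal N\bigl(0,\,4\,\widetilde\nu(m,\tau,c)\bigr)\qquad\text{as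 } n\to\infty.$$ -/

import Mathlib

namespace CSPCD

open MeasureTheory

noncomputable section

/-- The order statistic `y_(i)` of the finite set `Y`, for `1 ≤ i ≤ Y.card` (a dummy value for
`i > Y.card`; the index `0` is never used). -/
def orderStat (Y : Finset ℝ) (i : ℕ) : ℝ :=
  (Y.sort (· ≤ ·)).getD (i - 1) 0

/-- The end points `y_(0) = δ₁`, `y_(1) < ... < y_(m)`, `y_(m+1) = δ₂` of the intervals
`(y_(i-1), y_(i))`, `i = 1, ..., m + 1`, that the `m`-point set `Y` cuts out of `(δ₁, δ₂)`. -/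
def knot (δ₁ δ₂ : ℝ) (Y : Finset ℝ) (i : ℕ) : ℝ :=
  if i = 0 then δ₁ else if i ≤ Y.card then orderStat Y i else δ₂

/-- The relative length `w_i = (y_(i) - y_(i-1)) / (δ₂ - δ₁)` of the `i`-th interval,
`i = 1, ..., m + 1`. -/
def weight (δ₁ δ₂ : ℝ) (Y : Finset ℝ) (i : ℕ) : ℝ :=
  (knot δ₁ δ₂ Y i - knot δ₁ δ₂ Y (i - 1)) / (δ₂ - δ₁)

/-- The central similarity proximity region `N(x, τ, c)` of a point `x` of a middle interval
`(a, b)`, with centre `M_c = a + c (b - a)`. At `x = M_c` the two branches agree. -/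
def middleRegion (a b τ c x : ℝ) : Set ℝ :=
  if x < a + c * (b - a) then
    Set.Ioo (x - τ * (x - a)) (x + τ * (1 - c) * (x - a) / c) ∩ Set.Ioo a b
  else
    Set.Ioo (x - c * τ * (b - x) / (1 - c)) (x + τ * (b - x)) ∩ Set.Ioo a b

/-- The proximity region `N_e(x, τ)` of a point `x < y` of the left end interval `(-∞, y)`. -/
def leftEndRegion (y τ x : ℝ) : Set ℝ :=
  Set.Ioo (x - τ * (y - x)) (x + τ * (y - x)) ∩ Set.Iio y

/-- The proximity region `N_e(x, τ)` of a point `x > y` of the right end interval `(y, ∞)`. -/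
def rightEndRegion (y τ x : ℝ) : Set ℝ :=
  Set.Ioo (x - τ * (x - y)) (x + τ * (x - y)) ∩ Set.Ioi y

/-- The proximity region of an arbitrary point `x` of the line with respect to a nonempty finite
set `Y` with `m = Y.card` elements: it is `{x}` if `x ∈ Y`, the end-interval region if `x < y_(1)`
or `x > y_(m)`, and the middle-interval region if `y_(i-1) < x < y_(i)` with `2 ≤ i ≤ m`. -/
def proximityRegion (Y : Finset ℝ) (τ c x : ℝ) : Set ℝ :=
  {z | (x ∈ Y ∧ z = x) ∨
    (x < orderStat Y 1 ∧ z ∈ leftEndRegion (orderStat Y 1) τ x) ∨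
    (orderStat Y Y.card < x ∧ z ∈ rightEndRegion (orderStat Y Y.card) τ x) ∨
    ∃ i ∈ Finset.Icc 2 Y.card, x ∈ Set.Ioo (orderStat Y (i - 1)) (orderStat Y i) ∧
      z ∈ middleRegion (orderStat Y (i - 1)) (orderStat Y i) τ c x}

/-- The arcs (without loops) of the proximity catch digraph with vertices `x 0, ..., x (n-1)`. -/
def arcSet (Y : Finset ℝ) (τ c : ℝ) {n : ℕ} (x : Fin n → ℝ) : Set (Fin n × Fin n) :=
  {p | p.1 ≠ p.2 ∧ x p.2 ∈ proximityRegion Y τ c (x p.1)}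

/-- The relative density `|A| / (n (n - 1))`; it is `0` for `n ≤ 1`. -/
def relDensity (Y : Finset ℝ) (τ c : ℝ) {n : ℕ} (x : Fin n → ℝ) : ℝ :=
  ((arcSet Y τ c x).ncard : ℝ) / ((n : ℝ) * ((n : ℝ) - 1))

/-- The `Γ₁`-region of a set `B` with respect to the proximity map `N`. -/
def gammaOne (B : Set ℝ) (N : ℝ → Set ℝ) : Set ℝ :=
  {z | B ⊆ N z}

/-- The joint law of three independent random variables that are uniform on `(0, 1)`. -/
def unifTriple : Measure (ℝ × ℝ × ℝ) :=
  (volume.restrict (Set.Ioo 0 1)).prod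
    ((volume.restrict (Set.Ioo 0 1)).prod (volume.restrict (Set.Ioo 0 1)))

/-- `P({X₂, X₃} ⊆ N(X₁))` for independent uniform `X₁, X₂, X₃` on `(0, 1)`. -/
def prob2N (N : ℝ → Set ℝ) : ℝ :=
  unifTriple.real {p | {p.2.1, p.2.2} ⊆ N p.1}

/-- `P(X₂ ∈ N(X₁), X₃ ∈ Γ₁(X₁, N))` for independent uniform `X₁, X₂, X₃` on `(0, 1)`. -/
def probNG (N : ℝ → Set ℝ) : ℝ :=
  unifTriple.real {p | p.2.1 ∈ N p.1 ∧ p.2.2 ∈ gammaOne {p.1} N}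

/-- `P({X₂, X₃} ⊆ Γ₁(X₁, N))` for independent uniform `X₁, X₂, X₃` on `(0, 1)`. -/
def prob2G (N : ℝ → Set ℝ) : ℝ :=
  unifTriple.real {p | {p.2.1, p.2.2} ⊆ gammaOne {p.1} N}

/-- The arc probability `μ₁(τ, c)` of a middle interval, for `0 < c ≤ 1/2`. -/
def muOne (τ c : ℝ) : ℝ :=
  if τ < 1 then τ / 2
  else τ * (1 + 2 * c * (τ - 1) * (1 - c)) / (2 * (c * τ - c + 1) * (τ + c - c * τ))

/-- The arc probability `μ(τ, c)` of a middle interval. -/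
def muMiddle (τ c : ℝ) : ℝ :=
  if c ≤ 1 / 2 then muOne τ c else muOne τ (1 - c)

/-- The arc probability `μ_e(τ)` of an end interval. -/
def muEnd (τ : ℝ) : ℝ :=
  if τ < 1 then τ * (τ + 2) / (2 * (τ + 1)) else (1 + 2 * τ) / (2 * (τ + 1))

/-- The asymptotic mean
`μ̃ = μ(τ, c) ∑_{i=2}^{m} w_i² + μ_e(τ) ∑_{i ∈ {1, m+1}} w_i²`. -/
def muTilde (δ₁ δ₂ : ℝ) (Y : Finset ℝ) (τ c : ℝ) : ℝ :=
  muMiddle τ c * ∑ i ∈ Finset.Icc 2 Y.card, weight δ₁ δ₂ Y i ^ 2 +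
    muEnd τ * ∑ i ∈ {1, Y.card + 1}, weight δ₁ δ₂ Y i ^ 2

/-- The number `ν̃` given by
`4 ν̃ = [P_{2N} + 2 P_{NG} + P_{2G}] ∑_{i=2}^{m} w_i³
  + [P_{2N,e} + 2 P_{NG,e} + P_{2G,e}] ∑_{i ∈ {1, m+1}} w_i³ - 4 μ̃²`,
where the probabilities are those of the middle interval `(0, 1)`, and of the right end interval
`(0, 1)` (whose `Y`-point is `0`). -/
def nuTilde (δ₁ δ₂ : ℝ) (Y : Finset ℝ) (τ c : ℝ) : ℝ :=
  ((prob2N (middleRegion 0 1 τ c) + 2 * probNG (middleRegion 0 1 τ c)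
        + prob2G (middleRegion 0 1 τ c)) * ∑ i ∈ Finset.Icc 2 Y.card, weight δ₁ δ₂ Y i ^ 3 +
    (prob2N (rightEndRegion 0 τ) + 2 * probNG (rightEndRegion 0 τ)
        + prob2G (rightEndRegion 0 τ)) * ∑ i ∈ {1, Y.card + 1}, weight δ₁ δ₂ Y i ^ 3 -
    4 * muTilde δ₁ δ₂ Y τ c ^ 2) / 4

end

end CSPCD

/-! The relative density is a U-statistic of order two whose kernel, the indicator that `y` lies in
the region of `x`, is bounded but not symmetric. Its Hoeffding decomposition writes the kernel as
the sum of its two one-variable projections, minus the mean, plus a remainder that integrates to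
zero in each variable. The projections yield a sum of i.i.d. variables, to which the classical
central limit theorem applies. Remainder terms over different unordered pairs are uncorrelated, so
after scaling by `√n` the remainder has second moment `O(1/n)` and does not affect the limit. This
is `tendstoInDistribution_uStatistic`.

It remains to identify the mean and the variance. The uniform law on `(δ₁, δ₂)` is the mixture, with
weights `w_i`, of the uniform laws on the intervals between knots (`uniform_eq_mixture`). Arcs join
only points of the same interval, and the regions commute with affine maps, so each interval is a
copy of `(0, 1)` (`knotParam_mem_proximityRegion_iff`). Hence an interval contributes `w_i²` times
its arc probability to the mean and `w_i³` times the second moment of its projection to the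
variance. Expanding the square of the projection gives `P_{2N} + 2 P_{NG} + P_{2G}`
(`integral_kernelProj_regionKernel_sq`), and integrating the lengths of the regions gives `μ` and
`μ_e`. -/

open MeasureTheory ProbabilityTheory Filter Topology

/-! ### Central limit theorem for U-statistics of order two. -/

section UStatistic

variable {Ω E : Type*} [MeasurableSpace Ω] [MeasurableSpace E] {P : Measure Ω}
  [IsProbabilityMeasure P] {π : Measure E} [IsProbabilityMeasure π] {X : ℕ → Ω → E}

/-- The first-order projection `x ↦ E h(x, X) + E h(X, x)` of a kernel `h`. -/
noncomputable def kernelProj (π : Measure E) (h : E → E → ℝ) (x : E) : ℝ :=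
  (∫ y, h x y ∂π) + ∫ y, h y x ∂π

theorem abs_integral_le_of_abs_le {F : Type*} [MeasurableSpace F] {μ : Measure F}
    [IsProbabilityMeasure μ] {f : F → ℝ} {C : ℝ} (hC : ∀ x, |f x| ≤ C) : |∫ x, f x ∂μ| ≤ C := by
  simpa using norm_integral_le_of_norm_le_const (μ := μ) (f := f) (Eventually.of_forall hC)

theorem integrable_of_abs_le {F : Type*} [MeasurableSpace F] {μ : Measure F}
    [IsFiniteMeasure μ] {f : F → ℝ} (hf : AEStronglyMeasurable f μ) {C : ℝ}
    (hC : ∀ x, |f x| ≤ C) : Integrable f μ :=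
  Integrable.of_bound hf C (Eventually.of_forall hC)

theorem measurable_integral_left {h : E → E → ℝ} (hm : Measurable (Function.uncurry h)) :
    Measurable fun x => ∫ y, h x y ∂π :=
  (StronglyMeasurable.integral_prod_right (ν := π) hm.stronglyMeasurable).measurable

theorem measurable_integral_right {h : E → E → ℝ} (hm : Measurable (Function.uncurry h)) :
    Measurable fun x => ∫ y, h y x ∂π :=
  (StronglyMeasurable.integral_prod_left (μ := π) hm.stronglyMeasurable).measurable

theorem measurable_kernelProj {h : E → E → ℝ} (hm : Measurable (Function.uncurry h)) :
    Measurable (kernelProj π h) :=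
  (measurable_integral_left hm).add (measurable_integral_right hm)

theorem abs_kernelProj_le {h : E → E → ℝ} {C : ℝ} (hC : ∀ x y, |h x y| ≤ C) (x : E) :
    |kernelProj π h x| ≤ 2 * C := by
  have h1 := abs_integral_le_of_abs_le (μ := π) (hC x)
  have h2 := abs_integral_le_of_abs_le (μ := π) (fun y => hC y x)
  calc _ ≤ _ := abs_add_le _ _
    _ ≤ 2 * C := by linarith

theorem integral_kernelProj {h : E → E → ℝ} (hm : Measurable (Function.uncurry h)) {C : ℝ}
    (hC : ∀ x y, |h x y| ≤ C) : ∫ x, kernelProj π h x ∂π = 2 * ∫ x, ∫ y, h x y ∂π ∂π := by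
  have hi : Integrable (Function.uncurry h) (π.prod π) :=
    integrable_of_abs_le hm.aestronglyMeasurable (fun p => hC p.1 p.2)
  have h1 : Integrable (fun x => ∫ y, h x y ∂π) π := hi.integral_prod_left
  have h2 : Integrable (fun x => ∫ y, h y x ∂π) π := hi.integral_prod_right
  unfold kernelProj
  rw [integral_add h1 h2, integral_integral_swap hi]
  ring

/-- If `X_l` is independent of the finite family `(X_i)_{i ∈ S}` and `F(w, ·)` has mean zero for
every `w`, then `F((X_i)_{i ∈ S}, X_l)` has mean zero. -/
theorem integral_comp_eq_zero_of_indep (hX : ∀ i, HasLaw (X i) π P) (hind : iIndepFun X P)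
    {S : Finset ℕ} {l : ℕ} (hl : l ∉ S) {F : (S → E) × E → ℝ} (hF : Measurable F) {C : ℝ}
    (hC : ∀ p, |F p| ≤ C) (h0 : ∀ w, ∫ x, F (w, x) ∂π = 0) :
    ∫ ω, F (fun i => X i ω, X l ω) ∂P = 0 := by
  have hae : ∀ i, AEMeasurable (X i) P := fun i => (hX i).aemeasurable
  have hW : AEMeasurable (fun ω (i : S) => X i ω) P := aemeasurable_pi_lambda _ fun i => hae i
  have hi : IndepFun (fun ω (i : S) => X i ω) (X l) P :=
    (hind.indepFun_finset₀ S {l} (by simpa using hl) hae).comp (φ := id)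
      (ψ := fun f : (({l} : Finset ℕ) → E) => f ⟨l, by simp⟩) measurable_id (by fun_prop)
  have hmap := hi.map_prod_eq_prod_map_map hW (hae l)
  have := Measure.isProbabilityMeasure_map hW
  rw [← integral_map (φ := fun ω => ((fun i : S => X i ω), X l ω)) (hW.prodMk (hae l))
    hF.aestronglyMeasurable, hmap, (hX l).map_eq, integral_prod _
    (integrable_of_abs_le hF.aestronglyMeasurable hC)]
  simp [h0]

/-- Orthogonality: for a kernel `g` whose marginal means vanish, `g(X_i, X_j)` and `g(X_k, X_l)` are
uncorrelated unless `{i, j} = {k, l}`. -/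
theorem integral_mul_degenerate_eq_zero (hX : ∀ i, HasLaw (X i) π P) (hind : iIndepFun X P)
    {g : E → E → ℝ} (hg : Measurable (Function.uncurry g)) {C : ℝ} (hC : ∀ x y, |g x y| ≤ C)
    (hr : ∀ x, ∫ y, g x y ∂π = 0) (hl : ∀ y, ∫ x, g x y ∂π = 0) {p q : ℕ × ℕ}
    (hp : p.1 ≠ p.2) (hq : q.1 ≠ q.2) (h1 : q ≠ p) (h2 : q ≠ p.swap) :
    ∫ ω, g (X p.1 ω) (X p.2 ω) * g (X q.1 ω) (X q.2 ω) ∂P = 0 := by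
  obtain ⟨i, j⟩ := p
  obtain ⟨k, l⟩ := q
  simp only [Prod.swap_prod_mk, ne_eq, Prod.mk.injEq, not_and] at *
  have hbd : ∀ x y x' y', |g x y * g x' y'| ≤ C * C := fun x y x' y' => by
    rw [abs_mul]
    exact mul_le_mul (hC _ _) (hC _ _) (abs_nonneg _) ((abs_nonneg _).trans (hC x y))
  -- As `q` is neither `p` nor its swap, one index of `q` occurs nowhere else: `k` if `l` is shared
  -- with `p`, and `l` otherwise. Integrating over that variable alone gives zero.
  by_cases hcase : l = i ∨ l = j
  · have hk : k ∉ ({i, j, l} : Finset ℕ) := by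
      simp only [Finset.mem_insert, Finset.mem_singleton]; grind
    refine integral_comp_eq_zero_of_indep hX hind hk (F := fun p =>
      g (p.1 ⟨i, by simp⟩) (p.1 ⟨j, by simp⟩) * g p.2 (p.1 ⟨l, by simp⟩)) ?_
      (fun _ => hbd _ _ _ _) (fun w => ?_)
    · exact (hg.comp (f := fun p : (({i, j, l} : Finset ℕ) → E) × E =>
        (p.1 ⟨i, by simp⟩, p.1 ⟨j, by simp⟩)) (by fun_prop)).mul
        (hg.comp (f := fun p : (({i, j, l} : Finset ℕ) → E) × E =>
        (p.2, p.1 ⟨l, by simp⟩)) (by fun_prop))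
    · simp [integral_const_mul, hl]
  · have hk : l ∉ ({i, j, k} : Finset ℕ) := by
      simp only [Finset.mem_insert, Finset.mem_singleton]; grind
    refine integral_comp_eq_zero_of_indep hX hind hk (F := fun p =>
      g (p.1 ⟨i, by simp⟩) (p.1 ⟨j, by simp⟩) * g (p.1 ⟨k, by simp⟩) p.2) ?_
      (fun _ => hbd _ _ _ _) (fun w => ?_)
    · exact (hg.comp (f := fun p : (({i, j, k} : Finset ℕ) → E) × E =>
        (p.1 ⟨i, by simp⟩, p.1 ⟨j, by simp⟩)) (by fun_prop)).mul
        (hg.comp (f := fun p : (({i, j, k} : Finset ℕ) → E) × E =>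
        (p.1 ⟨k, by simp⟩, p.2)) (by fun_prop))
    · simp [integral_const_mul, hr]

omit [IsProbabilityMeasure P] [IsProbabilityMeasure π] in
theorem aemeasurable_kernel_comp (hX : ∀ i, HasLaw (X i) π P) {g : E → E → ℝ}
    (hg : Measurable (Function.uncurry g)) (i j : ℕ) :
    AEMeasurable (fun ω => g (X i ω) (X j ω)) P :=
  hg.comp_aemeasurable ((hX i).aemeasurable.prodMk (hX j).aemeasurable)

/-- When the square is expanded, orthogonality leaves for each pair `p` only `q = p` and `q =
p.swap`, each at most `C ^ 2`. The bound is thus linear, not quadratic, in the number of pairs. -/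
theorem integral_sq_sum_degenerate_le (hX : ∀ i, HasLaw (X i) π P) (hind : iIndepFun X P)
    {g : E → E → ℝ} (hg : Measurable (Function.uncurry g)) {C : ℝ} (hC : ∀ x y, |g x y| ≤ C)
    (hr : ∀ x, ∫ y, g x y ∂π = 0) (hl : ∀ y, ∫ x, g x y ∂π = 0) (n : ℕ) :
    ∫ ω, (∑ p ∈ (Finset.range n).offDiag, g (X p.1 ω) (X p.2 ω)) ^ 2 ∂P ≤
      2 * C ^ 2 * ((Finset.range n).offDiag.card : ℝ) := by
  have hbd : ∀ x y x' y', |g x y * g x' y'| ≤ C * C := fun x y x' y' => by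
    rw [abs_mul]
    exact mul_le_mul (hC _ _) (hC _ _) (abs_nonneg _) ((abs_nonneg _).trans (hC x y))
  have hint : ∀ p q : ℕ × ℕ,
      Integrable (fun ω => g (X p.1 ω) (X p.2 ω) * g (X q.1 ω) (X q.2 ω)) P := fun p q =>
    integrable_of_abs_le ((aemeasurable_kernel_comp hX hg _ _).mul
      (aemeasurable_kernel_comp hX hg _ _)).aestronglyMeasurable (fun _ => hbd _ _ _ _)
  have hterm : ∀ p ∈ (Finset.range n).offDiag, ∀ q ∈ (Finset.range n).offDiag,
      ∫ ω, g (X p.1 ω) (X p.2 ω) * g (X q.1 ω) (X q.2 ω) ∂P ≤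
        (if p = q then C ^ 2 else 0) + if p.swap = q then C ^ 2 else 0 := by
    intro p hp q hq
    have hle := (le_abs_self _).trans (abs_integral_le_of_abs_le (μ := P)
      (f := fun ω => g (X p.1 ω) (X p.2 ω) * g (X q.1 ω) (X q.2 ω)) (fun _ => hbd _ _ _ _))
    have hsq := sq_nonneg C
    by_cases h1 : p = q
    · rw [if_pos h1]; split_ifs <;> nlinarith
    by_cases h2 : p.swap = q
    · rw [if_pos h2]; split_ifs; nlinarith
    rw [if_neg h1, if_neg h2, integral_mul_degenerate_eq_zero hX hind hg hC hr hl
      (Finset.mem_offDiag.1 hp).2.2 (Finset.mem_offDiag.1 hq).2.2 (Ne.symm h1) (Ne.symm h2)]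
    simp
  simp_rw [sq (Finset.sum _ _), Finset.sum_mul_sum]
  rw [integral_finsetSum _ (fun p _ => integrable_finsetSum _ fun q _ => hint p q)]
  simp_rw [integral_finsetSum _ (fun q _ => hint _ q)]
  calc _ ≤ ∑ p ∈ (Finset.range n).offDiag, ∑ q ∈ (Finset.range n).offDiag,
        ((if p = q then C ^ 2 else 0) + if p.swap = q then C ^ 2 else 0) :=
        Finset.sum_le_sum fun p hp => Finset.sum_le_sum fun q hq => hterm p hp q hq
    _ ≤ ∑ p ∈ (Finset.range n).offDiag, 2 * C ^ 2 := by
        refine Finset.sum_le_sum fun p _ => ?_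
        rw [Finset.sum_add_distrib, Finset.sum_ite_eq, Finset.sum_ite_eq]
        have hsq := sq_nonneg C
        split_ifs <;> linarith
    _ = _ := by simp; ring

/-- Chebyshev's inequality. -/
theorem tendstoInMeasure_zero_of_integral_sq {Z : ℕ → Ω → ℝ}
    (hi : ∀ n, Integrable (fun ω => Z n ω ^ 2) P)
    (h : Tendsto (fun n => ∫ ω, Z n ω ^ 2 ∂P) atTop (𝓝 0)) : TendstoInMeasure P Z atTop 0 := by
  rw [tendstoInMeasure_iff_measureReal_norm]
  intro ε hε
  have hε2 : 0 < ε ^ 2 := by positivity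
  refine squeeze_zero (fun _ => measureReal_nonneg) (fun n => ?_)
    (by simpa using h.const_mul (ε ^ 2)⁻¹)
  have := mul_meas_ge_le_integral_of_nonneg (Eventually.of_forall fun ω => sq_nonneg (Z n ω))
    (hi n) (ε ^ 2)
  have hs : {ω | ε ≤ ‖Z n ω - (0 : Ω → ℝ) ω‖} = {ω | ε ^ 2 ≤ Z n ω ^ 2} := by
    ext ω
    simp only [Pi.zero_apply, sub_zero, Set.mem_ofPred_eq, Real.norm_eq_abs]
    rw [← sq_abs (Z n ω)]
    exact (pow_le_pow_iff_left₀ hε.le (abs_nonneg _) two_ne_zero).symm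
  rw [hs, inv_mul_eq_div, le_div_iff₀ hε2, mul_comm]
  exact this

theorem sum_offDiag_eq_sub (s : Finset ℕ) (f : ℕ × ℕ → ℝ) :
    ∑ p ∈ s.offDiag, f p = ∑ i ∈ s, ∑ j ∈ s, f (i, j) - ∑ i ∈ s, f (i, i) := by
  rw [← Finset.sum_product', ← Finset.diag_union_offDiag,
    Finset.sum_union (Finset.disjoint_diag_offDiag s), Finset.sum_diag]
  ring

theorem card_offDiag_range (n : ℕ) :
    ((Finset.range n).offDiag.card : ℝ) = (n : ℝ) * ((n : ℝ) - 1) := by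
  rw [Finset.offDiag_card, Finset.card_range, Nat.cast_sub (Nat.le_mul_self n)]
  push_cast; ring

/-- The degenerate part of a kernel in its Hoeffding decomposition. -/
noncomputable def kernelRemainder (π : Measure E) (h : E → E → ℝ) (x y : E) : ℝ :=
  h x y - (∫ z, h x z ∂π) - (∫ z, h z y ∂π) + ∫ z, ∫ z', h z z' ∂π ∂π

/-- Each index is the first entry of `n - 1` off-diagonal pairs and the second entry of `n - 1`
others; this is the factor in front of the projections. The identity is pointwise and purely
algebraic. -/
theorem sum_offDiag_kernelRemainder (π : Measure E) (h : E → E → ℝ) (x : ℕ → E) (n : ℕ) :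
    ∑ p ∈ (Finset.range n).offDiag, kernelRemainder π h (x p.1) (x p.2) =
      ∑ p ∈ (Finset.range n).offDiag, h (x p.1) (x p.2)
        - ((n : ℝ) - 1) * ∑ i ∈ Finset.range n, kernelProj π h (x i)
        + (n : ℝ) * ((n : ℝ) - 1) * ∫ z, ∫ z', h z z' ∂π ∂π := by
  simp only [kernelRemainder, kernelProj, Finset.sum_add_distrib, Finset.sum_sub_distrib,
    Finset.sum_const, nsmul_eq_mul, card_offDiag_range]
  simp only [sum_offDiag_eq_sub, Finset.sum_const, Finset.card_range, nsmul_eq_mul,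
    ← Finset.mul_sum]
  ring

variable {h : E → E → ℝ} {C : ℝ}

theorem measurable_kernelRemainder (hm : Measurable (Function.uncurry h)) :
    Measurable (Function.uncurry (kernelRemainder π h)) :=
  ((hm.sub ((measurable_integral_left hm).comp measurable_fst)).sub
    ((measurable_integral_right hm).comp measurable_snd)).add_const _

theorem abs_kernelRemainder_le (hC : ∀ x y, |h x y| ≤ C) (x y : E) :
    |kernelRemainder π h x y| ≤ 4 * C := by
  have h1 := abs_le.1 (hC x y)
  have h2 := abs_le.1 (abs_integral_le_of_abs_le (μ := π) (hC x))
  have h3 := abs_le.1 (abs_integral_le_of_abs_le (μ := π) (fun z => hC z y))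
  have h4 := abs_le.1 (abs_integral_le_of_abs_le (μ := π)
    (fun z => abs_integral_le_of_abs_le (μ := π) (hC z)))
  unfold kernelRemainder
  exact abs_le.2 ⟨by linarith, by linarith⟩

/-- Each subtracted marginal has the full mean of `h` as its own mean, so the mean is removed once
too often and is added back. Fubini is needed here because the second marginal is integrated in the
other order. -/
theorem integral_kernelRemainder_right (hm : Measurable (Function.uncurry h))
    (hC : ∀ x y, |h x y| ≤ C) (x : E) : ∫ y, kernelRemainder π h x y ∂π = 0 := by
  have hi : Integrable (Function.uncurry h) (π.prod π) :=
    integrable_of_abs_le hm.aestronglyMeasurable (fun p => hC p.1 p.2)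
  have h1 : Integrable (fun y => h x y) π :=
    integrable_of_abs_le hm.of_uncurry_left.aestronglyMeasurable (hC x)
  have h2 : Integrable (fun y => ∫ z, h z y ∂π) π := hi.integral_prod_right
  have h3 : Integrable (fun y => h x y - ∫ z, h x z ∂π) π := h1.sub (integrable_const _)
  have h4 : Integrable (fun y => h x y - (∫ z, h x z ∂π) - ∫ z, h z y ∂π) π := h3.sub h2
  unfold kernelRemainder
  rw [integral_add h4 (integrable_const _), integral_sub h3 h2,
    integral_sub h1 (integrable_const _),
    integral_integral_swap hi]
  simp

theorem integral_kernelRemainder_left (hm : Measurable (Function.uncurry h))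
    (hC : ∀ x y, |h x y| ≤ C) (y : E) : ∫ x, kernelRemainder π h x y ∂π = 0 := by
  have hi : Integrable (Function.uncurry h) (π.prod π) :=
    integrable_of_abs_le hm.aestronglyMeasurable (fun p => hC p.1 p.2)
  have h1 : Integrable (fun x => h x y) π :=
    integrable_of_abs_le hm.of_uncurry_right.aestronglyMeasurable (fun x => hC x y)
  have h2 : Integrable (fun x => ∫ z, h x z ∂π) π := hi.integral_prod_left
  have h3 : Integrable (fun x => h x y - ∫ z, h x z ∂π) π := h1.sub h2
  have h4 : Integrable (fun x => h x y - (∫ z, h x z ∂π) - ∫ z, h z y ∂π) π :=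
    h3.sub (integrable_const _)
  unfold kernelRemainder
  rw [integral_add h4 (integrable_const _), integral_sub h3 (integrable_const _),
    integral_sub h1 h2]
  simp

/-- Central limit theorem for the projection part of a U-statistic. -/
theorem tendstoInDistribution_sum_kernelProj (hX : ∀ i, HasLaw (X i) π P) (hind : iIndepFun X P)
    (hm : Measurable (Function.uncurry h)) (hC : ∀ x y, |h x y| ≤ C) :
    TendstoInDistribution (fun (n : ℕ) ω => (√(n : ℝ))⁻¹ *
        (∑ k ∈ Finset.range n, kernelProj π h (X k ω) - n * (2 * ∫ x, ∫ y, h x y ∂π ∂π)))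
      atTop (id : ℝ → ℝ) (fun _ => P) (gaussianReal 0 (Real.toNNReal
        (∫ x, kernelProj π h x ^ 2 ∂π - 4 * (∫ x, ∫ y, h x y ∂π ∂π) ^ 2))) := by
  have hpm := measurable_kernelProj (π := π) hm
  have hae : ∀ i, AEMeasurable (X i) P := fun i => (hX i).aemeasurable
  have hmap : ∀ f : E → ℝ, Measurable f → ∫ ω, f (X 0 ω) ∂P = ∫ x, f x ∂π := fun f hf => by
    rw [← (hX 0).map_eq, integral_map (hae 0) hf.aestronglyMeasurable]
  have hmean : P[fun ω => kernelProj π h (X 0 ω)] = 2 * ∫ x, ∫ y, h x y ∂π ∂π := by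
    rw [hmap _ hpm, integral_kernelProj hm hC]
  have hL2 : MemLp (fun ω => kernelProj π h (X 0 ω)) 2 P :=
    MemLp.of_bound (hpm.comp_aemeasurable (hae 0)).aestronglyMeasurable (2 * C)
      (Eventually.of_forall fun ω => abs_kernelProj_le hC _)
  have hvar : Var[fun ω => kernelProj π h (X 0 ω); P] =
      ∫ x, kernelProj π h x ^ 2 ∂π - 4 * (∫ x, ∫ y, h x y ∂π ∂π) ^ 2 := by
    rw [variance_eq_sub hL2, hmean]
    simp only [Pi.pow_apply]
    rw [hmap (fun x => kernelProj π h x ^ 2) (hpm.pow_const 2)]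
    ring
  have hident : ∀ i, IdentDistrib (fun ω => kernelProj π h (X i ω))
      (fun ω => kernelProj π h (X 0 ω)) P P := fun i =>
    (IdentDistrib.mk (hae i) (hae 0) ((hX i).map_eq.trans (hX 0).map_eq.symm)).comp hpm
  have hclt := tendstoInDistribution_inv_sqrt_mul_sum_sub (P := P)
    (X := fun i ω => kernelProj π h (X i ω)) (Y := (id : ℝ → ℝ))
    (P' := gaussianReal 0 Var[fun ω => kernelProj π h (X 0 ω); P].toNNReal)
    HasLaw.id hL2 (hind.comp (fun _ => kernelProj π h) fun _ => hpm) hident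
  simp only [hmean, hvar] at hclt
  exact hclt

/-- Central limit theorem for a U-statistic of order two with a bounded, not necessarily symmetric,
kernel. -/
theorem tendstoInDistribution_uStatistic (hX : ∀ i, HasLaw (X i) π P) (hind : iIndepFun X P)
    (hm : Measurable (Function.uncurry h)) (hC : ∀ x y, |h x y| ≤ C) :
    TendstoInDistribution (fun (n : ℕ) ω => √(n : ℝ) *
        ((∑ p ∈ (Finset.range n).offDiag, h (X p.1 ω) (X p.2 ω)) / ((n : ℝ) * ((n : ℝ) - 1)) -
          ∫ x, ∫ y, h x y ∂π ∂π))
      atTop (id : ℝ → ℝ) (fun _ => P) (gaussianReal 0 (Real.toNNReal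
        (∫ x, kernelProj π h x ^ 2 ∂π - 4 * (∫ x, ∫ y, h x y ∂π ∂π) ^ 2))) := by
  have hsum : ∀ g : E → E → ℝ, Measurable (Function.uncurry g) → ∀ n : ℕ, AEMeasurable
      (fun ω => ∑ p ∈ (Finset.range n).offDiag, g (X p.1 ω) (X p.2 ω)) P := fun g hg n =>
    Finset.aemeasurable_fun_sum _ fun p _ => aemeasurable_kernel_comp hX hg _ _
  -- Slutsky: it suffices that the difference from the projection sum tends to zero in measure.
  refine tendstoInDistribution_of_tendstoInMeasure_sub _ _
    (tendstoInDistribution_sum_kernelProj hX hind hm hC) ?_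
    (fun n => (((hsum h hm n).div_const _).sub_const _).const_mul _)
  have hgm := measurable_kernelRemainder (π := π) hm
  have hgC := abs_kernelRemainder_le (π := π) hC
  have key : TendstoInMeasure P (fun (n : ℕ) ω => √(n : ℝ) / ((n : ℝ) * ((n : ℝ) - 1)) *
      ∑ p ∈ (Finset.range n).offDiag, kernelRemainder π h (X p.1 ω) (X p.2 ω)) atTop 0 := by
    have hbd : ∀ (n : ℕ) ω,
        |∑ p ∈ (Finset.range n).offDiag, kernelRemainder π h (X p.1 ω) (X p.2 ω)| ≤
          (Finset.range n).offDiag.card * (4 * C) := fun n ω => by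
      refine (Finset.abs_sum_le_sum_abs _ _).trans ((Finset.sum_le_sum fun p _ => hgC _ _).trans ?_)
      simp
    refine tendstoInMeasure_zero_of_integral_sq (fun n => ?_) ?_
    · simp_rw [mul_pow]
      refine Integrable.const_mul (integrable_of_abs_le
        ((hsum _ hgm n).pow_const 2).aestronglyMeasurable
        (C := ((Finset.range n).offDiag.card * (4 * C)) ^ 2) fun ω => ?_) _
      rw [abs_pow]
      exact pow_le_pow_left₀ (abs_nonneg _) (hbd n ω) 2
    -- The remainder is bounded by `4 * C`, so the second moment is at most `n / (n (n - 1))²` times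
    -- `2 (4 C)² n (n - 1)`, which is this sequence.
    · have hlim : Tendsto (fun n : ℕ => 2 * (4 * C) ^ 2 * ((n : ℝ) - 1)⁻¹) atTop (𝓝 0) := by
        simpa using! (tendsto_inv_atTop_zero.comp (tendsto_atTop_add_const_right _ (-1 : ℝ)
          tendsto_natCast_atTop_atTop)).const_mul (2 * (4 * C) ^ 2)
      refine squeeze_zero' (Eventually.of_forall fun n => integral_nonneg fun ω => sq_nonneg _)
        ?_ hlim
      filter_upwards [eventually_ge_atTop 2] with n hn
      have hn' : (2 : ℝ) ≤ n := by exact_mod_cast hn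
      have hn1 : (0 : ℝ) < n - 1 := by linarith
      have hle := integral_sq_sum_degenerate_le hX hind hgm hgC
        (integral_kernelRemainder_right hm hC) (integral_kernelRemainder_left hm hC) n
      simp_rw [mul_pow]
      rw [integral_const_mul]
      refine (mul_le_mul_of_nonneg_left hle (sq_nonneg _)).trans (le_of_eq ?_)
      rw [card_offDiag_range, div_pow, Real.sq_sqrt (Nat.cast_nonneg n)]
      field_simp
  refine key.congr' ?_ Filter.EventuallyEq.rfl
  -- For `n ≥ 2` the divisor `n (n - 1)` is non-zero, and the difference of the two statistics is
  -- exactly the rescaled remainder.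
  filter_upwards [eventually_ge_atTop 2] with n hn
  refine Eventually.of_forall fun ω => ?_
  have hn' : (2 : ℝ) ≤ n := by exact_mod_cast hn
  have hn1 : (n : ℝ) - 1 ≠ 0 := by linarith
  have hs : (√(n : ℝ)) ≠ 0 := by positivity
  have hss : √(n : ℝ) ^ 2 = n := Real.sq_sqrt (Nat.cast_nonneg n)
  simp only [Pi.sub_apply, sum_offDiag_kernelRemainder π h (fun i => X i ω)]
  have hinv : (√(n : ℝ))⁻¹ = √(n : ℝ) / n := by
    rw [← hss]; field_simp; simp
  rw [hinv]
  field_simp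
  ring

end UStatistic

/-! ### Kernels that couple only points of the same component of a mixture. -/

section Mixture

variable {ι E F : Type*} [MeasurableSpace E] [MeasurableSpace F] {U : Measure F}
  [IsProbabilityMeasure U] {π : Measure E} {s : Finset ι} {w : ι → ℝ} {φ : ι → F → E}

theorem integral_mixture (hw : ∀ i ∈ s, 0 ≤ w i) (hφ : ∀ i, Measurable (φ i))
    (hπ : π = ∑ i ∈ s, ENNReal.ofReal (w i) • U.map (φ i)) {f : E → ℝ} (hf : Measurable f) {C : ℝ}
    (hC : ∀ x, |f x| ≤ C) : ∫ x, f x ∂π = ∑ i ∈ s, w i * ∫ u, f (φ i u) ∂U := by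
  have (i : ι) : IsFiniteMeasure (ENNReal.ofReal (w i) • U.map (φ i)) :=
    Measure.smul_finite _ ENNReal.ofReal_ne_top
  rw [hπ, integral_finsetSum_measure fun i _ =>
    integrable_of_abs_le hf.aestronglyMeasurable hC]
  refine Finset.sum_congr rfl fun i hi => ?_
  rw [integral_smul_measure, ENNReal.toReal_ofReal (hw i hi),
    integral_map (hφ i).aemeasurable hf.aestronglyMeasurable, smul_eq_mul]

variable [DecidableEq ι] {k : E → E → ℝ} {κ : ι → F → F → ℝ} {C : ℝ}

/-- A kernel that couples only points of the same component of a mixture has, on each component,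
a projection proportional to the one of the component. -/
theorem kernelProj_mixture (hw : ∀ i ∈ s, 0 ≤ w i) (hφ : ∀ i, Measurable (φ i))
    (hπ : π = ∑ i ∈ s, ENNReal.ofReal (w i) • U.map (φ i)) (hk : Measurable (Function.uncurry k))
    (hC : ∀ x y, |k x y| ≤ C) {T : Set F} (hT : ∀ᵐ u ∂U, u ∈ T)
    (hkκ : ∀ i ∈ s, ∀ j ∈ s, ∀ u ∈ T, ∀ v ∈ T, k (φ i u) (φ j v) = if i = j then κ i u v else 0)
    {i : ι} (hi : i ∈ s) {u : F} (hu : u ∈ T) :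
    ∫ y, k (φ i u) y ∂π = w i * ∫ v, κ i u v ∂U ∧
      ∫ y, k y (φ i u) ∂π = w i * ∫ v, κ i v u ∂U := by
  constructor
  · rw [integral_mixture hw hφ hπ hk.of_uncurry_left (hC _)]
    rw [Finset.sum_eq_single_of_mem i hi]
    · congr 1
      refine integral_congr_ae ?_
      filter_upwards [hT] with v hv
      simp [hkκ i hi i hi u hu v hv]
    · intro j hj hji
      rw [integral_congr_ae (g := fun _ => 0)]
      · simp
      filter_upwards [hT] with v hv
      simp [hkκ i hi j hj u hu v hv, Ne.symm hji]
  · rw [integral_mixture hw hφ hπ hk.of_uncurry_right (fun y => hC y _)]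
    rw [Finset.sum_eq_single_of_mem i hi]
    · congr 1
      refine integral_congr_ae ?_
      filter_upwards [hT] with v hv
      simp [hkκ i hi i hi v hv u hu]
    · intro j hj hji
      rw [integral_congr_ae (g := fun _ => 0)]
      · simp
      filter_upwards [hT] with v hv
      simp [hkκ j hj i hi v hv u hu, hji]

/-- One weight is the chance that `x` falls into component `i`, the other that `y` falls into the
same one. The coupling is required only on a set `T` of full measure, which lets boundary points be
ignored. -/
theorem integral_integral_mixture [IsProbabilityMeasure π] (hw : ∀ i ∈ s, 0 ≤ w i)
    (hφ : ∀ i, Measurable (φ i))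
    (hπ : π = ∑ i ∈ s, ENNReal.ofReal (w i) • U.map (φ i)) (hk : Measurable (Function.uncurry k))
    (hC : ∀ x y, |k x y| ≤ C) {T : Set F} (hT : ∀ᵐ u ∂U, u ∈ T)
    (hkκ : ∀ i ∈ s, ∀ j ∈ s, ∀ u ∈ T, ∀ v ∈ T, k (φ i u) (φ j v) = if i = j then κ i u v else 0) :
    ∫ x, ∫ y, k x y ∂π ∂π = ∑ i ∈ s, w i ^ 2 * ∫ u, ∫ v, κ i u v ∂U ∂U := by
  rw [integral_mixture hw hφ hπ (measurable_integral_left hk)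
    (fun x => abs_integral_le_of_abs_le (hC x))]
  refine Finset.sum_congr rfl fun i hi => ?_
  rw [sq, mul_assoc]
  congr 1
  rw [← integral_const_mul]
  refine integral_congr_ae ?_
  filter_upwards [hT] with u hu
  exact (kernelProj_mixture hw hφ hπ hk hC hT hkκ hi hu).1

/-- On component `i` the projection is `w i` times that of `κ i`; squaring gives two weights and the
outer integral the third. -/
theorem integral_kernelProj_sq_mixture [IsProbabilityMeasure π] (hw : ∀ i ∈ s, 0 ≤ w i)
    (hφ : ∀ i, Measurable (φ i))
    (hπ : π = ∑ i ∈ s, ENNReal.ofReal (w i) • U.map (φ i)) (hk : Measurable (Function.uncurry k))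
    (hC : ∀ x y, |k x y| ≤ C) {T : Set F} (hT : ∀ᵐ u ∂U, u ∈ T)
    (hkκ : ∀ i ∈ s, ∀ j ∈ s, ∀ u ∈ T, ∀ v ∈ T, k (φ i u) (φ j v) = if i = j then κ i u v else 0) :
    ∫ x, kernelProj π k x ^ 2 ∂π = ∑ i ∈ s, w i ^ 3 * ∫ u, kernelProj U (κ i) u ^ 2 ∂U := by
  rw [integral_mixture hw hφ hπ ((measurable_kernelProj hk).pow_const 2) (C := (2 * C) ^ 2)
    (fun x => by
      rw [abs_pow]; exact pow_le_pow_left₀ (abs_nonneg _) (abs_kernelProj_le hC x) 2)]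
  refine Finset.sum_congr rfl fun i hi => ?_
  rw [show w i ^ 3 = w i * w i ^ 2 by ring, mul_assoc]
  congr 1
  rw [← integral_const_mul]
  refine integral_congr_ae ?_
  filter_upwards [hT] with u hu
  obtain ⟨h1, h2⟩ := kernelProj_mixture hw hφ hπ hk hC hT hkκ hi hu
  simp only [kernelProj, h1, h2]
  ring

end Mixture

/-! ### Indicator kernels and the probabilities for three uniform points. -/

section RelationKernel

variable {F : Type*} [MeasurableSpace F] {U : Measure F} [IsProbabilityMeasure U]

/-- The indicator kernel `(x, y) ↦ 1` if `y ∈ N x` and `0` otherwise. -/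
noncomputable def regionKernel {E : Type*} (N : E → Set E) (x y : E) : ℝ :=
  (N x).indicator 1 y

theorem abs_regionKernel_le {E : Type*} (N : E → Set E) (x y : E) : |regionKernel N x y| ≤ 1 := by
  by_cases h : y ∈ N x <;> simp [regionKernel, h]

theorem measurable_regionKernel {N : F → Set F} (hN : MeasurableSet {p : F × F | p.2 ∈ N p.1}) :
    Measurable (Function.uncurry (regionKernel N)) := by
  have : Function.uncurry (regionKernel N) = {p : F × F | p.2 ∈ N p.1}.indicator 1 := by
    ext p
    by_cases h : p.2 ∈ N p.1 <;> simp [regionKernel, Function.uncurry, h]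
  rw [this]
  exact measurable_one.indicator hN

/-- Given the first point, the conditions on the other two are independent, so the sections factor.
-/
theorem measureReal_prod_prod {k₁ k₂ : F → F → ℝ} {A : Set (F × F × F)} (hA : MeasurableSet A)
    (hk : ∀ p, A.indicator 1 p = k₁ p.1 p.2.1 * k₂ p.1 p.2.2) :
    (U.prod (U.prod U)).real A = ∫ x, (∫ y, k₁ x y ∂U) * ∫ y, k₂ x y ∂U ∂U := by
  have hi : Integrable (A.indicator (1 : F × F × F → ℝ)) (U.prod (U.prod U)) :=
    (integrable_const (1 : ℝ)).indicator hA
  rw [← integral_indicator_one hA, integral_prod _ hi]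
  simp_rw [hk, integral_prod_mul]

end RelationKernel

-- The projection at `u` is the probability that a uniform point lies in `N u` plus the probability
-- that it lies in `Γ₁(u, N)`. The three terms of the square of this sum are the three
-- probabilities.
open CSPCD in
theorem integral_kernelProj_regionKernel_sq {N : ℝ → Set ℝ}
    (hN : MeasurableSet {p : ℝ × ℝ | p.2 ∈ N p.1}) :
    ∫ u, kernelProj (volume.restrict (Set.Ioo (0 : ℝ) 1)) (regionKernel N) u ^ 2
        ∂(volume.restrict (Set.Ioo (0 : ℝ) 1)) =
      prob2N N + 2 * probNG N + prob2G N := by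
  have hU : IsProbabilityMeasure (volume.restrict (Set.Ioo (0 : ℝ) 1)) := ⟨by simp⟩
  set U := volume.restrict (Set.Ioo (0 : ℝ) 1) with hUdef
  have m1 := measurable_regionKernel hN
  have m2 : Measurable (Function.uncurry fun x y => regionKernel N y x) := m1.comp measurable_swap
  have b1 := abs_regionKernel_le N
  have A1 : MeasurableSet {p : ℝ × ℝ × ℝ | p.2.1 ∈ N p.1} :=
    hN.preimage (f := fun p : ℝ × ℝ × ℝ => (p.1, p.2.1)) (by fun_prop)
  have A2 : MeasurableSet {p : ℝ × ℝ × ℝ | p.2.2 ∈ N p.1} :=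
    hN.preimage (f := fun p : ℝ × ℝ × ℝ => (p.1, p.2.2)) (by fun_prop)
  have B1 : MeasurableSet {p : ℝ × ℝ × ℝ | p.1 ∈ N p.2.1} :=
    hN.preimage (f := fun p : ℝ × ℝ × ℝ => (p.2.1, p.1)) (by fun_prop)
  have B2 : MeasurableSet {p : ℝ × ℝ × ℝ | p.1 ∈ N p.2.2} :=
    hN.preimage (f := fun p : ℝ × ℝ × ℝ => (p.2.2, p.1)) (by fun_prop)
  have e1 : prob2N N = ∫ x, (∫ y, regionKernel N x y ∂U) * ∫ y, regionKernel N x y ∂U ∂U := by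
    refine measureReal_prod_prod ?_ fun p => ?_
    · convert A1.inter A2 using 1
      ext p; simp [Set.insert_subset_iff]
    · by_cases h1 : p.2.1 ∈ N p.1 <;> by_cases h2 : p.2.2 ∈ N p.1 <;>
        simp [regionKernel, Set.insert_subset_iff, h1, h2]
  have e2 : probNG N = ∫ x, (∫ y, regionKernel N x y ∂U) * ∫ y, regionKernel N y x ∂U ∂U := by
    refine measureReal_prod_prod ?_ fun p => ?_
    · convert A1.inter B2 using 1
      ext p; simp [gammaOne]
    · by_cases h1 : p.2.1 ∈ N p.1 <;> by_cases h2 : p.1 ∈ N p.2.2 <;>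
        simp [regionKernel, gammaOne, h1, h2]
  have e3 : prob2G N = ∫ x, (∫ y, regionKernel N y x ∂U) * ∫ y, regionKernel N y x ∂U ∂U := by
    refine measureReal_prod_prod ?_ fun p => ?_
    · convert B1.inter B2 using 1
      ext p; simp [gammaOne, Set.insert_subset_iff]
    · by_cases h1 : p.1 ∈ N p.2.1 <;> by_cases h2 : p.1 ∈ N p.2.2 <;>
        simp [regionKernel, gammaOne, Set.insert_subset_iff, h1, h2]
  have ma : Measurable fun x => ∫ y, regionKernel N x y ∂U := measurable_integral_left m1
  have mb : Measurable fun x => ∫ y, regionKernel N y x ∂U := measurable_integral_right m1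
  have hmul : ∀ {f g : ℝ → ℝ}, Measurable f → Measurable g → (∀ x, |f x| ≤ 1) →
      (∀ x, |g x| ≤ 1) → Integrable (fun x => f x * g x) U := fun hf hg hf1 hg1 =>
    integrable_of_abs_le (hf.mul hg).aestronglyMeasurable (C := 1) fun x => by
      rw [abs_mul]; exact mul_le_one₀ (hf1 x) (abs_nonneg _) (hg1 x)
  have ba := fun x => abs_integral_le_of_abs_le (μ := U) (b1 x)
  have bb := fun x => abs_integral_le_of_abs_le (μ := U) (fun y => b1 y x)
  have iaa := hmul ma ma ba ba
  have iab := hmul ma mb ba bb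
  have ibb := hmul mb mb bb bb
  have hsq : ∀ u, kernelProj U (regionKernel N) u ^ 2 =
      (∫ y, regionKernel N u y ∂U) * (∫ y, regionKernel N u y ∂U) +
      (2 * ((∫ y, regionKernel N u y ∂U) * ∫ y, regionKernel N y u ∂U) +
      (∫ y, regionKernel N y u ∂U) * ∫ y, regionKernel N y u ∂U) := fun u => by
    simp only [kernelProj]; ring
  have iab2 : Integrable (fun u => 2 * ((∫ y, regionKernel N u y ∂U) *
      ∫ y, regionKernel N y u ∂U)) U := iab.const_mul 2
  have isum : Integrable (fun u => 2 * ((∫ y, regionKernel N u y ∂U) *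
      ∫ y, regionKernel N y u ∂U) + (∫ y, regionKernel N y u ∂U) *
      ∫ y, regionKernel N y u ∂U) U := iab2.add ibb
  simp_rw [hsq]
  rw [e1, e2, e3, integral_add iaa isum, integral_add iab2 ibb, integral_const_mul]
  ring

/-! ### Order statistics, knots and the intervals between them. -/

namespace CSPCD

theorem orderStat_eq_getElem {Y : Finset ℝ} {i : ℕ} (hi : 1 ≤ i) (hi' : i ≤ Y.card) :
    orderStat Y i = (Y.sort (· ≤ ·))[i - 1]'(by rw [Finset.length_sort]; omega) := by
  unfold orderStat
  rw [List.getD_eq_getElem]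

theorem orderStat_mem {Y : Finset ℝ} {i : ℕ} (hi : 1 ≤ i) (hi' : i ≤ Y.card) :
    orderStat Y i ∈ Y := by
  rw [orderStat_eq_getElem hi hi', ← Finset.mem_sort (· ≤ ·)]
  exact List.getElem_mem _

theorem orderStat_lt {Y : Finset ℝ} {i j : ℕ} (hi : 1 ≤ i) (hij : i < j) (hj : j ≤ Y.card) :
    orderStat Y i < orderStat Y j := by
  rw [orderStat_eq_getElem hi (by omega), orderStat_eq_getElem (by omega) hj]
  exact (Finset.sortedLT_sort Y).strictMono_get
    (a := ⟨i - 1, by rw [Finset.length_sort]; omega⟩)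
    (b := ⟨j - 1, by rw [Finset.length_sort]; omega⟩) (by simp only [Fin.mk_lt_mk]; omega)

theorem exists_orderStat_eq {Y : Finset ℝ} {y : ℝ} (hy : y ∈ Y) :
    ∃ i, 1 ≤ i ∧ i ≤ Y.card ∧ orderStat Y i = y := by
  rw [← Finset.mem_sort (· ≤ ·)] at hy
  obtain ⟨k, hk, rfl⟩ := List.getElem_of_mem hy
  have hk' := hk
  rw [Finset.length_sort] at hk'
  exact ⟨k + 1, by omega, by omega, by rw [orderStat_eq_getElem (by omega) (by omega)]; simp⟩

variable {δ₁ δ₂ : ℝ} {Y : Finset ℝ}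

theorem knot_eq_orderStat {i : ℕ} (hi : 1 ≤ i) (hi' : i ≤ Y.card) :
    knot δ₁ δ₂ Y i = orderStat Y i := by
  rw [knot, if_neg (by omega), if_pos hi']

theorem knot_zero : knot δ₁ δ₂ Y 0 = δ₁ := by simp [knot]

theorem knot_card_succ : knot δ₁ δ₂ Y (Y.card + 1) = δ₂ := by simp [knot]

/-- The bound on `j` is needed: past `Y.card + 1` the knots stay at `δ₂`. -/
theorem knot_lt_knot (hδ : δ₁ < δ₂) (hY : ∀ y ∈ Y, δ₁ < y ∧ y < δ₂) {i j : ℕ} (hij : i < j)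
    (hj : j ≤ Y.card + 1) : knot δ₁ δ₂ Y i < knot δ₁ δ₂ Y j := by
  rcases Nat.eq_zero_or_pos i with rfl | hi <;> rcases Nat.lt_or_eq_of_le hj with hj | rfl
  · rw [knot_zero, knot_eq_orderStat (by omega) (by omega)]
    exact (hY _ (orderStat_mem (by omega) (by omega))).1
  · rwa [knot_zero, knot_card_succ]
  · rw [knot_eq_orderStat hi (by omega), knot_eq_orderStat (by omega) (by omega)]
    exact orderStat_lt hi hij (by omega)
  · rw [knot_card_succ, knot_eq_orderStat hi (by omega)]
    exact (hY _ (orderStat_mem (by omega) (by omega))).2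

theorem knot_le_knot (hδ : δ₁ < δ₂) (hY : ∀ y ∈ Y, δ₁ < y ∧ y < δ₂) {i j : ℕ} (hij : i ≤ j)
    (hj : j ≤ Y.card + 1) : knot δ₁ δ₂ Y i ≤ knot δ₁ δ₂ Y j := by
  rcases hij.lt_or_eq with h | rfl
  · exact (knot_lt_knot hδ hY h hj).le
  · rfl

/-- The `i`-th interval that `Y` cuts out of `(δ₁, δ₂)`. -/
noncomputable def knotInterval (δ₁ δ₂ : ℝ) (Y : Finset ℝ) (i : ℕ) : Set ℝ :=
  Set.Ioo (knot δ₁ δ₂ Y (i - 1)) (knot δ₁ δ₂ Y i)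

theorem eq_of_mem_knotInterval (hδ : δ₁ < δ₂) (hY : ∀ y ∈ Y, δ₁ < y ∧ y < δ₂) {i j : ℕ}
    (hi : i ∈ Finset.Icc 1 (Y.card + 1)) (hj : j ∈ Finset.Icc 1 (Y.card + 1)) {x : ℝ}
    (hxi : x ∈ knotInterval δ₁ δ₂ Y i) (hxj : x ∈ knotInterval δ₁ δ₂ Y j) : i = j := by
  rw [Finset.mem_Icc] at hi hj
  by_contra hne
  rcases Nat.lt_or_gt_of_ne hne with h | h
  · have := knot_le_knot hδ hY (show i ≤ j - 1 by omega) (by omega)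
    exact absurd (hxi.2.trans_le this) (not_lt.2 hxj.1.le)
  · have := knot_le_knot hδ hY (show j ≤ i - 1 by omega) (by omega)
    exact absurd (hxj.2.trans_le this) (not_lt.2 hxi.1.le)

theorem notMem_of_mem_knotInterval (hδ : δ₁ < δ₂) (hY : ∀ y ∈ Y, δ₁ < y ∧ y < δ₂) {i : ℕ}
    (hi : i ∈ Finset.Icc 1 (Y.card + 1)) {x : ℝ} (hx : x ∈ knotInterval δ₁ δ₂ Y i) : x ∉ Y := by
  rw [Finset.mem_Icc] at hi
  intro hxY
  obtain ⟨k, hk, hk', rfl⟩ := exists_orderStat_eq hxY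
  rw [← knot_eq_orderStat (δ₁ := δ₁) (δ₂ := δ₂) hk hk'] at hx
  rcases Nat.lt_or_ge k i with h | h
  · exact absurd hx.1 (not_lt.2 (knot_le_knot hδ hY (by omega) (by omega)))
  · exact absurd hx.2 (not_lt.2 (knot_le_knot hδ hY h (by omega)))

theorem lt_orderStat_one_iff (hδ : δ₁ < δ₂) (hY : ∀ y ∈ Y, δ₁ < y ∧ y < δ₂) (hm : 1 ≤ Y.card)
    {i : ℕ} (hi : i ∈ Finset.Icc 1 (Y.card + 1)) {x : ℝ} (hx : x ∈ knotInterval δ₁ δ₂ Y i) :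
    x < orderStat Y 1 ↔ i = 1 := by
  rw [Finset.mem_Icc] at hi
  rw [← knot_eq_orderStat (δ₁ := δ₁) (δ₂ := δ₂) le_rfl hm]
  refine ⟨fun h => ?_, fun h => h ▸ hx.2⟩
  by_contra hne
  exact absurd h (not_lt.2 ((knot_le_knot hδ hY (by omega) (by omega)).trans hx.1.le))

theorem orderStat_card_lt_iff (hδ : δ₁ < δ₂) (hY : ∀ y ∈ Y, δ₁ < y ∧ y < δ₂) (hm : 1 ≤ Y.card)
    {i : ℕ} (hi : i ∈ Finset.Icc 1 (Y.card + 1)) {x : ℝ} (hx : x ∈ knotInterval δ₁ δ₂ Y i) :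
    orderStat Y Y.card < x ↔ i = Y.card + 1 := by
  rw [Finset.mem_Icc] at hi
  rw [← knot_eq_orderStat (δ₁ := δ₁) (δ₂ := δ₂) hm le_rfl]
  refine ⟨fun h => ?_, fun h => by subst h; exact hx.1⟩
  by_contra hne
  exact absurd h (not_lt.2 (hx.2.le.trans (knot_le_knot hδ hY (by omega) (by omega))))

theorem mem_Ioo_orderStat_iff (hδ : δ₁ < δ₂) (hY : ∀ y ∈ Y, δ₁ < y ∧ y < δ₂)
    {i j : ℕ} (hi : i ∈ Finset.Icc 1 (Y.card + 1)) (hj : j ∈ Finset.Icc 2 Y.card) {x : ℝ}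
    (hx : x ∈ knotInterval δ₁ δ₂ Y i) :
    x ∈ Set.Ioo (orderStat Y (j - 1)) (orderStat Y j) ↔ i = j := by
  rw [Finset.mem_Icc] at hj
  rw [← knot_eq_orderStat (δ₁ := δ₁) (δ₂ := δ₂) (i := j) (by omega) (by omega),
    ← knot_eq_orderStat (δ₁ := δ₁) (δ₂ := δ₂) (i := j - 1) (by omega) (by omega)]
  refine ⟨fun h => ?_, fun h => h ▸ hx⟩
  exact eq_of_mem_knotInterval hδ hY hi (Finset.mem_Icc.2 ⟨by omega, by omega⟩) hx h

/-! ### Affine transfer of the proximity regions to the unit interval. -/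

/-- The parametrization of the `i`-th interval by `(0, 1)`; the first interval is reflected, so
that its `Y`-point corresponds to `0`. -/
noncomputable def knotParam (δ₁ δ₂ : ℝ) (Y : Finset ℝ) (i : ℕ) (u : ℝ) : ℝ :=
  if i = 1 then knot δ₁ δ₂ Y 1 - (knot δ₁ δ₂ Y 1 - knot δ₁ δ₂ Y 0) * u
  else knot δ₁ δ₂ Y (i - 1) + (knot δ₁ δ₂ Y i - knot δ₁ δ₂ Y (i - 1)) * u

/-- The proximity map of the `i`-th interval in the parametrization by `(0, 1)`. -/
noncomputable def unitRegion (Y : Finset ℝ) (τ c : ℝ) (i : ℕ) : ℝ → Set ℝ :=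
  if i ∈ Finset.Icc 2 Y.card then middleRegion 0 1 τ c else rightEndRegion 0 τ

theorem measurable_knotParam (i : ℕ) : Measurable (knotParam δ₁ δ₂ Y i) := by
  unfold knotParam
  split_ifs <;> fun_prop

theorem knotParam_mem (hδ : δ₁ < δ₂) (hY : ∀ y ∈ Y, δ₁ < y ∧ y < δ₂)
    {i : ℕ} (hi : i ∈ Finset.Icc 1 (Y.card + 1)) {u : ℝ} (hu : u ∈ Set.Ioo (0 : ℝ) 1) :
    knotParam δ₁ δ₂ Y i u ∈ knotInterval δ₁ δ₂ Y i := by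
  rw [Finset.mem_Icc] at hi
  have hlt := knot_lt_knot hδ hY (show i - 1 < i by omega) hi.2
  obtain ⟨h0, h1⟩ := hu
  unfold knotParam knotInterval
  split_ifs with h
  · subst h
    simp only [Nat.sub_self] at *
    exact ⟨by nlinarith, by nlinarith⟩
  · exact ⟨by nlinarith, by nlinarith⟩

/-- Both end points of the region, and the centre, are carried along by the increasing map `p ↦ a +
(b - a) p`. No condition on `c` enters, as both sides divide by the same constants. -/
theorem mem_middleRegion_affine {a b τ c u v : ℝ} (hab : a < b) :
    a + (b - a) * v ∈ middleRegion a b τ c (a + (b - a) * u) ↔ v ∈ middleRegion 0 1 τ c u := by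
  have hL : 0 < b - a := sub_pos.2 hab
  have key : ∀ p q : ℝ, a + (b - a) * p < a + (b - a) * q ↔ p < q := fun p q => by
    rw [add_lt_add_iff_left, mul_lt_mul_iff_right₀ hL]
  have hcond : a + (b - a) * u < a + c * (b - a) ↔ u < c := by
    rw [mul_comm c, key]
  have e0 : a = a + (b - a) * 0 := by ring
  have e1 : b = a + (b - a) * 1 := by ring
  unfold middleRegion
  rw [show (0 : ℝ) + c * (1 - 0) = c by ring]
  by_cases h : u < c
  · rw [if_pos (hcond.2 h), if_pos h]
    have l : a + (b - a) * u - τ * (a + (b - a) * u - a) = a + (b - a) * (u - τ * (u - 0)) := by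
      ring
    have r : a + (b - a) * u + τ * (1 - c) * (a + (b - a) * u - a) / c =
      a + (b - a) * (u + τ * (1 - c) * (u - 0) / c) := by ring
    have p0 : a < a + (b - a) * v ↔ 0 < v := by simpa using key 0 v
    have p1 : a + (b - a) * v < b ↔ v < 1 := by simpa using key v 1
    simp only [Set.mem_inter_iff, Set.mem_Ioo, l, r, key, p0, p1]
  · rw [if_neg (hcond.not.2 h), if_neg h]
    have l : a + (b - a) * u - c * τ * (b - (a + (b - a) * u)) / (1 - c) =
      a + (b - a) * (u - c * τ * (1 - u) / (1 - c)) := by ring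
    have r : a + (b - a) * u + τ * (b - (a + (b - a) * u)) =
      a + (b - a) * (u + τ * (1 - u)) := by ring
    have p0 : a < a + (b - a) * v ↔ 0 < v := by simpa using key 0 v
    have p1 : a + (b - a) * v < b ↔ v < 1 := by simpa using key v 1
    simp only [Set.mem_inter_iff, Set.mem_Ioo, l, r, key, p0, p1]

/-- The region depends only on the distance to its `Y`-point and is not cut off at the far end, so
any scale `L > 0` is allowed. -/
theorem mem_rightEndRegion_affine {a L τ u v : ℝ} (hL : 0 < L) :
    a + L * v ∈ rightEndRegion a τ (a + L * u) ↔ v ∈ rightEndRegion 0 τ u := by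
  have key : ∀ p q : ℝ, a + L * p < a + L * q ↔ p < q := fun p q => by
    rw [add_lt_add_iff_left, mul_lt_mul_iff_right₀ hL]
  have l : a + L * u - τ * (a + L * u - a) = a + L * (u - τ * (u - 0)) := by ring
  have r : a + L * u + τ * (a + L * u - a) = a + L * (u + τ * (u - 0)) := by ring
  have p0 : a < a + L * v ↔ 0 < v := by simpa using key 0 v
  simp only [rightEndRegion, Set.mem_inter_iff, Set.mem_Ioo, Set.mem_Ioi, l, r, key, p0]

theorem mem_leftEndRegion_affine {a L τ u v : ℝ} (hL : 0 < L) :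
    a - L * v ∈ leftEndRegion a τ (a - L * u) ↔ v ∈ rightEndRegion 0 τ u := by
  have key : ∀ p q : ℝ, a - L * p < a - L * q ↔ q < p := fun p q => by
    rw [sub_lt_sub_iff_left, mul_lt_mul_iff_right₀ hL]
  have l : a - L * u - τ * (a - (a - L * u)) = a - L * (u + τ * (u - 0)) := by ring
  have r : a - L * u + τ * (a - (a - L * u)) = a - L * (u - τ * (u - 0)) := by ring
  have p0 : a - L * v < a ↔ 0 < v := by simpa using key v 0
  simp only [leftEndRegion, rightEndRegion, Set.mem_inter_iff, Set.mem_Ioo, Set.mem_Ioi,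
    Set.mem_Iio, l, r, key, p0]
  -- The reflection has exchanged the two end points, so only the order of the inequalities differs.
  tauto

/-- Inside a knot interval exactly one of the four alternatives defining the region is possible. -/
theorem mem_proximityRegion_iff (hδ : δ₁ < δ₂) (hY : ∀ y ∈ Y, δ₁ < y ∧ y < δ₂) (hm : 1 ≤ Y.card)
    {τ c : ℝ} {i : ℕ} (hi : i ∈ Finset.Icc 1 (Y.card + 1)) {x : ℝ}
    (hx : x ∈ knotInterval δ₁ δ₂ Y i) (z : ℝ) :
    z ∈ proximityRegion Y τ c x ↔ z ∈ if i = 1 then leftEndRegion (orderStat Y 1) τ x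
      else if i = Y.card + 1 then rightEndRegion (orderStat Y Y.card) τ x
      else middleRegion (orderStat Y (i - 1)) (orderStat Y i) τ c x := by
  have hmid : (∃ j ∈ Finset.Icc 2 Y.card, x ∈ Set.Ioo (orderStat Y (j - 1)) (orderStat Y j) ∧
      z ∈ middleRegion (orderStat Y (j - 1)) (orderStat Y j) τ c x) ↔
      (i ∈ Finset.Icc 2 Y.card ∧ z ∈ middleRegion (orderStat Y (i - 1)) (orderStat Y i) τ c x) := by
    constructor
    · rintro ⟨j, hj, hxj, hz⟩
      obtain rfl := (mem_Ioo_orderStat_iff hδ hY hi hj hx).1 hxj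
      exact ⟨hj, hz⟩
    · rintro ⟨hi2, hz⟩
      exact ⟨i, hi2, (mem_Ioo_orderStat_iff hδ hY hi hi2 hx).2 rfl, hz⟩
  simp only [proximityRegion, Set.mem_ofPred_eq, notMem_of_mem_knotInterval hδ hY hi hx, false_and,
    false_or, lt_orderStat_one_iff hδ hY hm hi hx, orderStat_card_lt_iff hδ hY hm hi hx, hmid]
  rw [Finset.mem_Icc] at *
  have hne : (1 : ℕ) ≠ Y.card + 1 := by omega
  split_ifs with h1 h2
  · subst h1
    simp only [true_and, hne, false_and, show ¬ 2 ≤ 1 by omega, or_false]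
  · subst h2
    simp only [true_and, h1, false_and, false_or, show ¬ Y.card + 1 ≤ Y.card by omega, and_false,
      or_false]
  · simp [h1, h2, show 2 ≤ i by omega, show i ≤ Y.card by omega]

/-- Every region is cut down to its own interval, and distinct intervals are disjoint, so no arc
leaves an interval; within one, the affine transfer applies. -/
theorem knotParam_mem_proximityRegion_iff (hδ : δ₁ < δ₂) (hY : ∀ y ∈ Y, δ₁ < y ∧ y < δ₂)
    (hm : 1 ≤ Y.card) {τ c : ℝ} {i j : ℕ} (hi : i ∈ Finset.Icc 1 (Y.card + 1))
    (hj : j ∈ Finset.Icc 1 (Y.card + 1)) {u v : ℝ} (hu : u ∈ Set.Ioo (0 : ℝ) 1)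
    (hv : v ∈ Set.Ioo (0 : ℝ) 1) :
    knotParam δ₁ δ₂ Y j v ∈ proximityRegion Y τ c (knotParam δ₁ δ₂ Y i u) ↔
      i = j ∧ v ∈ unitRegion Y τ c i u := by
  have hx := knotParam_mem hδ hY hi hu
  have hz := knotParam_mem hδ hY hj hv
  rw [mem_proximityRegion_iff hδ hY hm hi hx]
  have hi' := Finset.mem_Icc.1 hi
  have hj' := Finset.mem_Icc.1 hj
  have hlt := knot_lt_knot hδ hY (show i - 1 < i by omega) hi'.2
  by_cases hij : i = j
  · subst hij
    simp only [true_and, knotParam, unitRegion]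
    split_ifs with h1 h2 h2 h3 h3
    · simp [h1] at h2
    · subst h1
      rw [knot_eq_orderStat (i := 1) le_rfl hm] at hlt ⊢
      exact mem_leftEndRegion_affine (sub_pos.2 hlt)
    · rw [Finset.mem_Icc] at h3; omega
    · subst h2
      simp only [Nat.add_sub_cancel] at *
      rw [knot_eq_orderStat (i := Y.card) hm le_rfl] at hlt ⊢
      exact mem_rightEndRegion_affine (sub_pos.2 hlt)
    · rw [knot_eq_orderStat (i := i) (by omega) (by omega),
        knot_eq_orderStat (i := i - 1) (by omega) (by omega)] at hlt ⊢
      exact mem_middleRegion_affine hlt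
    · rw [Finset.mem_Icc] at h3; omega
  · simp only [hij, false_and, iff_false]
    split_ifs with h1 h2
    · intro h
      exact hij (h1.trans ((lt_orderStat_one_iff hδ hY hm hj hz).1 h.2).symm)
    · intro h
      exact hij (h2.trans ((orderStat_card_lt_iff hδ hY hm hj hz).1 h.2).symm)
    · intro h
      refine hij ((mem_Ioo_orderStat_iff hδ hY hj (Finset.mem_Icc.2 ⟨by omega, by omega⟩) hz).1
        ?_).symm
      unfold middleRegion at h
      split_ifs at h
      exacts [h.2, h.2]

/-! ### Joint measurability of the regions. -/

theorem measurableSet_snd_mem_Ioo {f g : ℝ × ℝ → ℝ} (hf : Measurable f) (hg : Measurable g) :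
    MeasurableSet {p : ℝ × ℝ | p.2 ∈ Set.Ioo (f p) (g p)} :=
  (measurableSet_lt hf measurable_snd).inter (measurableSet_lt measurable_snd hg)

theorem measurableSet_rightEndRegion (y τ : ℝ) :
    MeasurableSet {p : ℝ × ℝ | p.2 ∈ rightEndRegion y τ p.1} :=
  (measurableSet_snd_mem_Ioo (by fun_prop) (by fun_prop)).inter
    (measurableSet_Ioi.preimage measurable_snd)

theorem measurableSet_leftEndRegion (y τ : ℝ) :
    MeasurableSet {p : ℝ × ℝ | p.2 ∈ leftEndRegion y τ p.1} :=
  (measurableSet_snd_mem_Ioo (by fun_prop) (by fun_prop)).inter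
    (measurableSet_Iio.preimage measurable_snd)

theorem measurableSet_middleRegion (a b τ c : ℝ) :
    MeasurableSet {p : ℝ × ℝ | p.2 ∈ middleRegion a b τ c p.1} := by
  have hs : MeasurableSet {p : ℝ × ℝ | p.1 < a + c * (b - a)} :=
    measurableSet_lt measurable_fst measurable_const
  have h0 : MeasurableSet {p : ℝ × ℝ | p.2 ∈ Set.Ioo a b} :=
    measurableSet_Ioo.preimage measurable_snd
  have h1 : MeasurableSet {p : ℝ × ℝ | p.2 ∈ Set.Ioo (p.1 - τ * (p.1 - a))
      (p.1 + τ * (1 - c) * (p.1 - a) / c)} :=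
    measurableSet_snd_mem_Ioo (by fun_prop) (by fun_prop)
  have h2 : MeasurableSet {p : ℝ × ℝ | p.2 ∈ Set.Ioo (p.1 - c * τ * (b - p.1) / (1 - c))
      (p.1 + τ * (b - p.1))} :=
    measurableSet_snd_mem_Ioo (by fun_prop) (by fun_prop)
  convert (hs.inter (h1.inter h0)).union (hs.compl.inter (h2.inter h0)) using 1
  ext p
  by_cases h : p.1 < a + c * (b - a) <;> simp [middleRegion, h]

theorem measurableSet_proximityRegion (Y : Finset ℝ) (τ c : ℝ) :
    MeasurableSet {p : ℝ × ℝ | p.2 ∈ proximityRegion Y τ c p.1} := by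
  have h1 : MeasurableSet {p : ℝ × ℝ | p.1 ∈ Y ∧ p.2 = p.1} :=
    (Y.measurableSet.preimage measurable_fst).inter
      (measurableSet_eq_fun measurable_snd measurable_fst)
  have h2 : MeasurableSet {p : ℝ × ℝ | p.1 < orderStat Y 1 ∧
      p.2 ∈ leftEndRegion (orderStat Y 1) τ p.1} :=
    (measurableSet_lt measurable_fst measurable_const).inter (measurableSet_leftEndRegion _ _)
  have h3 : MeasurableSet {p : ℝ × ℝ | orderStat Y Y.card < p.1 ∧
      p.2 ∈ rightEndRegion (orderStat Y Y.card) τ p.1} :=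
    (measurableSet_lt measurable_const measurable_fst).inter (measurableSet_rightEndRegion _ _)
  have h4 : MeasurableSet (⋃ i ∈ Finset.Icc 2 Y.card,
      {p : ℝ × ℝ | p.1 ∈ Set.Ioo (orderStat Y (i - 1)) (orderStat Y i) ∧
      p.2 ∈ middleRegion (orderStat Y (i - 1)) (orderStat Y i) τ c p.1}) :=
    Finset.measurableSet_biUnion _ fun i _ =>
      (measurableSet_Ioo.preimage measurable_fst).inter (measurableSet_middleRegion _ _ _ _)
  convert h1.union (h2.union (h3.union h4)) using 1
  ext p
  simp only [proximityRegion, Set.mem_ofPred_eq, Set.mem_union, Set.mem_iUnion, exists_prop]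

/-! ### The uniform law as a mixture. -/

theorem restrict_Ioo_eq_smul_map_of_pos {a b : ℝ} (hab : a < b) :
    volume.restrict (Set.Ioo a b) = ENNReal.ofReal (b - a) •
      (volume.restrict (Set.Ioo (0 : ℝ) 1)).map (fun u => a + (b - a) * u) := by
  have hL : 0 < b - a := sub_pos.2 hab
  ext s hs
  have hf : Measurable fun u : ℝ => a + (b - a) * u := by fun_prop
  -- The affine map is split into a scaling and a translation, whose effects on Lebesgue measure are
  -- known.
  have hpre : (fun u : ℝ => a + (b - a) * u) ⁻¹' s ∩ Set.Ioo 0 1 =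
      (fun u : ℝ => (b - a) * u) ⁻¹' ((fun x => a + x) ⁻¹' (s ∩ Set.Ioo a b)) := by
    ext u
    simp only [Set.mem_inter_iff, Set.mem_preimage, Set.mem_Ioo]
    refine and_congr_right fun _ => and_congr ?_ ?_
    · exact ⟨fun h => by nlinarith, fun h => by nlinarith⟩
    · exact ⟨fun h => by nlinarith, fun h => by nlinarith⟩
  rw [Measure.restrict_apply hs, Measure.smul_apply, Measure.map_apply hf hs,
    Measure.restrict_apply (hf hs), hpre, Real.volume_preimage_mul_left hL.ne',
    measure_preimage_add, smul_eq_mul, ← mul_assoc, abs_of_pos (inv_pos.2 hL),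
    ← ENNReal.ofReal_mul hL.le, mul_inv_cancel₀ hL.ne', ENNReal.ofReal_one, one_mul]

theorem map_one_sub_restrict_Ioo :
    (volume.restrict (Set.Ioo (0 : ℝ) 1)).map (fun u => 1 - u) =
      volume.restrict (Set.Ioo (0 : ℝ) 1) := by
  have h := (Measure.measurePreserving_sub_left (volume : Measure ℝ) 1).restrict_preimage
    (measurableSet_Ioo (a := (0 : ℝ)) (b := 1))
  have he : (fun u : ℝ => 1 - u) ⁻¹' Set.Ioo 0 1 = Set.Ioo 0 1 := by
    ext u; simp only [Set.mem_preimage, Set.mem_Ioo]; constructor <;> rintro ⟨_, _⟩ <;>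
      constructor <;> linarith
  rw [he] at h
  exact h.map_eq

theorem restrict_knotInterval (hδ : δ₁ < δ₂) (hY : ∀ y ∈ Y, δ₁ < y ∧ y < δ₂) {i : ℕ}
    (hi : i ∈ Finset.Icc 1 (Y.card + 1)) :
    volume.restrict (knotInterval δ₁ δ₂ Y i) =
      ENNReal.ofReal (knot δ₁ δ₂ Y i - knot δ₁ δ₂ Y (i - 1)) •
      (volume.restrict (Set.Ioo (0 : ℝ) 1)).map (knotParam δ₁ δ₂ Y i) := by
  rw [Finset.mem_Icc] at hi
  have hlt := knot_lt_knot hδ hY (show i - 1 < i by omega) hi.2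
  rw [knotInterval, restrict_Ioo_eq_smul_map_of_pos hlt]
  congr 1
  by_cases h : i = 1
  · subst h
    -- The reflected parametrization after `u ↦ 1 - u` is the increasing one, and `u ↦ 1 - u`
    -- preserves the uniform law.
    conv_rhs => rw [← map_one_sub_restrict_Ioo]
    rw [Measure.map_map (measurable_knotParam 1) (by fun_prop)]
    congr 1
    ext u
    simp only [knotParam, Function.comp_apply, if_true, Nat.sub_self]
    ring
  · congr 1
    ext u
    simp [knotParam, h]

theorem restrict_Ioo_eq_sum (hδ : δ₁ < δ₂) (hY : ∀ y ∈ Y, δ₁ < y ∧ y < δ₂) :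
    volume.restrict (Set.Ioo δ₁ δ₂) =
      ∑ i ∈ Finset.Icc 1 (Y.card + 1), volume.restrict (knotInterval δ₁ δ₂ Y i) := by
  -- Half-open intervals join without gaps, which makes the induction exact; passing to open ones
  -- costs only null sets.
  have key : ∀ n ≤ Y.card + 1, volume.restrict (Set.Ioc δ₁ (knot δ₁ δ₂ Y n)) =
      ∑ i ∈ Finset.Icc 1 n, volume.restrict (knotInterval δ₁ δ₂ Y i) := by
    intro n
    induction n with
    | zero => intro _; simp [knot_zero]
    | succ n ih =>
      intro hn
      rw [Finset.sum_Icc_succ_top (by omega), ← ih (by omega), knotInterval, Nat.add_sub_cancel,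
        restrict_Ioo_eq_restrict_Ioc, ← Measure.restrict_union
          (Set.Ioc_disjoint_Ioc_of_le le_rfl) measurableSet_Ioc, Set.Ioc_union_Ioc_eq_Ioc]
      · simpa [knot_zero] using knot_le_knot hδ hY (Nat.zero_le n) (by omega)
      · exact knot_le_knot hδ hY (by omega) hn
  rw [restrict_Ioo_eq_restrict_Ioc, ← key _ le_rfl, knot_card_succ]

theorem weight_nonneg (hδ : δ₁ < δ₂) (hY : ∀ y ∈ Y, δ₁ < y ∧ y < δ₂) {i : ℕ}
    (hi : i ∈ Finset.Icc 1 (Y.card + 1)) : 0 ≤ weight δ₁ δ₂ Y i := by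
  rw [Finset.mem_Icc] at hi
  exact div_nonneg (sub_nonneg.2 (knot_le_knot hδ hY (by omega) hi.2)) (sub_nonneg.2 hδ.le)

/-- The uniform law on `(δ₁, δ₂)` is the mixture of the uniform laws on the intervals. -/
theorem uniform_eq_mixture (hδ : δ₁ < δ₂) (hY : ∀ y ∈ Y, δ₁ < y ∧ y < δ₂) :
    ProbabilityTheory.cond volume (Set.Ioo δ₁ δ₂) =
      ∑ i ∈ Finset.Icc 1 (Y.card + 1), ENNReal.ofReal (weight δ₁ δ₂ Y i) •
        (volume.restrict (Set.Ioo (0 : ℝ) 1)).map (knotParam δ₁ δ₂ Y i) := by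
  have hL : 0 < δ₂ - δ₁ := sub_pos.2 hδ
  rw [ProbabilityTheory.cond, restrict_Ioo_eq_sum hδ hY, Finset.smul_sum]
  refine Finset.sum_congr rfl fun i hi => ?_
  rw [restrict_knotInterval hδ hY hi, smul_smul, Real.volume_Ioo, ← ENNReal.ofReal_inv_of_pos hL,
    ← ENNReal.ofReal_mul (inv_pos.2 hL).le, weight, div_eq_inv_mul]

/-! ### The arc probabilities as integrals of lengths. -/

theorem integral_regionKernel (N : ℝ → Set ℝ) {u : ℝ} (hN : MeasurableSet (N u)) :
    ∫ v, regionKernel N u v ∂(volume.restrict (Set.Ioo (0 : ℝ) 1)) =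
      volume.real (N u ∩ Set.Ioo 0 1) := by
  unfold regionKernel
  rw [integral_indicator_one hN, measureReal_restrict_apply hN]

/-- The integrand is a ramp up to `1 / s` and then `1`; it misses a triangle of area `1 / (2 s)`.
The hypothesis `1 ≤ s * t` places the kink inside `[0, t]`. -/
theorem integral_min_one_mul {s t : ℝ} (hs : 0 < s) (hst : 1 ≤ s * t) :
    ∫ u in (0 : ℝ)..t, min 1 (s * u) = t - 1 / (2 * s) := by
  have hc : Continuous fun u : ℝ => min 1 (s * u) := by fun_prop
  have h0 : (0 : ℝ) ≤ 1 / s := by positivity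
  have h1 : 1 / s ≤ t := by rw [div_le_iff₀ hs]; linarith
  rw [← intervalIntegral.integral_add_adjacent_intervals (b := 1 / s)
    (hc.intervalIntegrable _ _) (hc.intervalIntegrable _ _),
    intervalIntegral.integral_congr (g := fun u => s * u) (a := 0) (b := 1 / s),
    intervalIntegral.integral_congr (g := fun _ => 1) (a := 1 / s) (b := t),
    intervalIntegral.integral_const_mul, integral_id, intervalIntegral.integral_const]
  · simp only [smul_eq_mul]; field_simp; ring
  · intro u hu
    rw [Set.uIcc_of_le h1] at hu
    exact min_eq_left (by have := hu.1; rw [div_le_iff₀ hs] at this; linarith)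
  · intro u hu
    rw [Set.uIcc_of_le h0] at hu
    exact min_eq_right (by have := hu.2; rw [le_div_iff₀ hs] at this; linarith)

theorem integral_length_rightEndRegion {τ : ℝ} (hτ : 0 < τ) :
    ∫ u, ∫ v, regionKernel (rightEndRegion 0 τ) u v ∂(volume.restrict (Set.Ioo (0 : ℝ) 1))
      ∂(volume.restrict (Set.Ioo (0 : ℝ) 1)) = muEnd τ := by
  have hlen : ∀ u ∈ Set.Ioo (0 : ℝ) 1,
      ∫ v, regionKernel (rightEndRegion 0 τ) u v ∂(volume.restrict (Set.Ioo (0 : ℝ) 1)) =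
        min 1 ((1 + τ) * u) - max 0 (1 - τ) * u := by
    intro u hu
    obtain ⟨h0, h1⟩ := hu
    -- The lower end `(1 - τ) u` is cut at `0` by the region itself, the upper end `(1 + τ) u` at
    -- `1` by the range of the second point.
    have hset : rightEndRegion 0 τ u ∩ Set.Ioo 0 1 =
        Set.Ioo (max 0 (1 - τ) * u) (min 1 ((1 + τ) * u)) := by
      ext z
      rw [max_mul_of_nonneg _ _ h0.le]
      simp only [rightEndRegion, Set.mem_inter_iff, Set.mem_Ioo, Set.mem_Ioi, max_lt_iff,
        lt_min_iff]
      constructor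
      · rintro ⟨⟨⟨_, _⟩, _⟩, _, _⟩
        refine ⟨⟨?_, ?_⟩, ?_, ?_⟩ <;> linarith
      · rintro ⟨⟨_, _⟩, _, _⟩
        refine ⟨⟨⟨?_, ?_⟩, ?_⟩, ?_, ?_⟩ <;> linarith
    rw [integral_regionKernel _ (measurableSet_Ioo.inter measurableSet_Ioi), hset,
      Real.volume_real_Ioo_of_le]
    have hm : max 0 (1 - τ) ≤ 1 := max_le zero_le_one (by linarith)
    have hm' : max 0 (1 - τ) * u ≤ u := by nlinarith
    exact le_min (by linarith) (by nlinarith)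
  rw [setIntegral_congr_fun measurableSet_Ioo hlen, ← integral_Ioc_eq_integral_Ioo,
    ← intervalIntegral.integral_of_le zero_le_one, intervalIntegral.integral_sub
      (Continuous.intervalIntegrable (by fun_prop) _ _)
      (Continuous.intervalIntegrable (by fun_prop) _ _), integral_min_one_mul (by linarith)
      (by linarith), intervalIntegral.integral_const_mul, integral_id, muEnd]
  have h1 : 1 + τ ≠ 0 := by positivity
  have h2 : τ + 1 ≠ 0 := by positivity
  split_ifs with h
  · rw [max_eq_right (by linarith)]
    field_simp
    ring
  · rw [max_eq_left (by linarith)]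
    field_simp
    ring

/-- Replacing `c` by `1 - c` swaps the two factors of the denominator. So the case distinction in
`muMiddle` changes nothing. -/
theorem muOne_one_sub (τ c : ℝ) : muOne τ (1 - c) = muOne τ c := by
  unfold muOne
  split_ifs
  · rfl
  · congr 1 <;> ring

theorem muMiddle_eq_muOne (τ c : ℝ) : muMiddle τ c = muOne τ c := by
  unfold muMiddle
  split_ifs
  · rfl
  · exact muOne_one_sub τ c

theorem measurableSet_middleRegion_apply (a b τ c x : ℝ) :
    MeasurableSet (middleRegion a b τ c x) := by
  unfold middleRegion
  split_ifs <;> exact measurableSet_Ioo.inter measurableSet_Ioo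

theorem length_middleRegion_left {τ c : ℝ} (hτ : 0 < τ) (hc₀ : 0 < c) (hc₁ : c < 1) {u : ℝ}
    (hu : 0 < u) (huc : u < c) :
    ∫ v, regionKernel (middleRegion 0 1 τ c) u v ∂(volume.restrict (Set.Ioo (0 : ℝ) 1)) =
      min 1 ((1 + τ * (1 - c) / c) * u) - max 0 (1 - τ) * u := by
  have hset : middleRegion 0 1 τ c u ∩ Set.Ioo 0 1 =
      Set.Ioo (max 0 (1 - τ) * u) (min 1 ((1 + τ * (1 - c) / c) * u)) := by
    ext z
    have e : (1 + τ * (1 - c) / c) * u = u + τ * (1 - c) * (u - 0) / c := by ring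
    rw [max_mul_of_nonneg _ _ hu.le, e, middleRegion, if_pos (by linarith)]
    simp only [Set.mem_inter_iff, Set.mem_Ioo, max_lt_iff, lt_min_iff]
    constructor
    · rintro ⟨⟨⟨_, _⟩, _⟩, _, _⟩
      refine ⟨⟨?_, ?_⟩, ?_, ?_⟩ <;> linarith
    · rintro ⟨⟨_, _⟩, _, _⟩
      refine ⟨⟨⟨?_, ?_⟩, ?_, ?_⟩, ?_, ?_⟩ <;> linarith
  rw [integral_regionKernel _ (measurableSet_middleRegion_apply _ _ _ _ _), hset,
    Real.volume_real_Ioo_of_le]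
  have hm : max 0 (1 - τ) ≤ 1 := max_le zero_le_one (by linarith)
  have hm' : max 0 (1 - τ) * u ≤ u := by nlinarith
  have hp : 0 ≤ τ * (1 - c) / c := div_nonneg (mul_nonneg hτ.le (by linarith)) hc₀.le
  exact le_min (by linarith) (by nlinarith)

/-- Mirror image of the left branch under `u ↦ 1 - u` and `c ↦ 1 - c`. The form `1 - (1 - c)` is
kept so that `integral_length_half` applies verbatim with `1 - c` for `c`. -/
theorem length_middleRegion_right {τ c : ℝ} (hτ : 0 < τ) (hc₀ : 0 < c) (hc₁ : c < 1) {u : ℝ}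
    (hu : u < 1) (huc : c ≤ u) :
    ∫ v, regionKernel (middleRegion 0 1 τ c) u v ∂(volume.restrict (Set.Ioo (0 : ℝ) 1)) =
      min 1 ((1 + τ * (1 - (1 - c)) / (1 - c)) * (1 - u)) - max 0 (1 - τ) * (1 - u) := by
  have hset : middleRegion 0 1 τ c u ∩ Set.Ioo 0 1 =
      Set.Ioo (1 - min 1 ((1 + τ * (1 - (1 - c)) / (1 - c)) * (1 - u)))
        (1 - max 0 (1 - τ) * (1 - u)) := by
    ext z
    have e : (1 + τ * (1 - (1 - c)) / (1 - c)) * (1 - u) =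
      1 - (u - c * τ * (1 - u) / (1 - c)) := by ring
    rw [max_mul_of_nonneg _ _ (by linarith), e, middleRegion, if_neg (by linarith)]
    simp only [Set.mem_inter_iff, Set.mem_Ioo, sub_lt_comm (a := (1 : ℝ)) (c := z),
      lt_sub_comm (a := z), max_lt_iff, lt_min_iff]
    constructor
    · rintro ⟨⟨⟨_, _⟩, _⟩, _, _⟩
      refine ⟨⟨?_, ?_⟩, ?_, ?_⟩ <;> linarith
    · rintro ⟨⟨_, _⟩, _, _⟩
      refine ⟨⟨⟨?_, ?_⟩, ?_, ?_⟩, ?_, ?_⟩ <;> linarith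
  rw [integral_regionKernel _ (measurableSet_middleRegion_apply _ _ _ _ _), hset,
    Real.volume_real_Ioo_of_le]
  · ring
  have hm : max 0 (1 - τ) ≤ 1 := max_le zero_le_one (by linarith)
  have hm' : max 0 (1 - τ) * (1 - u) ≤ 1 - u := by nlinarith
  have hp : 0 ≤ τ * (1 - (1 - c)) / (1 - c) := div_nonneg (mul_nonneg hτ.le (by linarith))
    (by linarith)
  have : max 0 (1 - τ) * (1 - u) ≤ min 1 ((1 + τ * (1 - (1 - c)) / (1 - c)) * (1 - u)) :=
    le_min (by linarith) (by nlinarith)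
  linarith

theorem integral_length_half {τ c : ℝ} (hτ : 0 < τ) (hc₀ : 0 < c) (hc₁ : c < 1) :
    ∫ u in (0 : ℝ)..c, (min 1 ((1 + τ * (1 - c) / c) * u) - max 0 (1 - τ) * u) =
      if τ < 1 then τ * c / 2 else c - c / (2 * (c + τ * (1 - c))) := by
  have hs : 0 < 1 + τ * (1 - c) / c := by
    have : 0 ≤ τ * (1 - c) / c := div_nonneg (mul_nonneg hτ.le (by linarith)) hc₀.le
    linarith
  -- The value of the upper end at `u = c`. It is below `1` for `τ < 1`, so no cut occurs and the
  -- length is `τ / c * u`; for `τ ≥ 1` it is at least `1`, so the kink lies in `[0, c]`.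
  have hsc : (1 + τ * (1 - c) / c) * c = c + τ * (1 - c) := by field_simp
  split_ifs with h
  · rw [max_eq_right (by linarith),
      intervalIntegral.integral_congr (g := fun u => τ / c * u)]
    · rw [intervalIntegral.integral_const_mul, integral_id]
      field_simp
      ring
    · intro u hu
      rw [Set.uIcc_of_le hc₀.le] at hu
      have hle : (1 + τ * (1 - c) / c) * u ≤ 1 := by
        refine (mul_le_mul_of_nonneg_left hu.2 hs.le).trans ?_
        rw [hsc]; nlinarith
      simp only [min_eq_right hle]
      field_simp
      ring
  · rw [max_eq_left (by linarith)]
    simp only [zero_mul, sub_zero]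
    rw [integral_min_one_mul hs (by rw [hsc]; nlinarith)]
    have : 0 < c + τ * (1 - c) := by nlinarith
    have e : 1 + τ * (1 - c) / c = (c + τ * (1 - c)) / c := by field_simp
    rw [e]
    field_simp

theorem integral_length_middleRegion {τ c : ℝ} (hτ : 0 < τ) (hc₀ : 0 < c) (hc₁ : c < 1) :
    ∫ u, ∫ v, regionKernel (middleRegion 0 1 τ c) u v ∂(volume.restrict (Set.Ioo (0 : ℝ) 1))
      ∂(volume.restrict (Set.Ioo (0 : ℝ) 1)) = muMiddle τ c := by
  have hint : IntervalIntegrable (fun u => ∫ v, regionKernel (middleRegion 0 1 τ c) u v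
      ∂(volume.restrict (Set.Ioo (0 : ℝ) 1))) volume 0 1 := by
    have hU : IsProbabilityMeasure (volume.restrict (Set.Ioo (0 : ℝ) 1)) := ⟨by simp⟩
    rw [intervalIntegrable_iff_integrableOn_Ioo_of_le zero_le_one]
    exact integrable_of_abs_le (measurable_integral_left (measurable_regionKernel
      (measurableSet_middleRegion 0 1 τ c))).aestronglyMeasurable
      fun x => abs_integral_le_of_abs_le (abs_regionKernel_le _ x)
  rw [← integral_Ioc_eq_integral_Ioo, ← intervalIntegral.integral_of_le zero_le_one,
    ← intervalIntegral.integral_add_adjacent_intervals (b := c)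
      (hint.mono_set (Set.uIcc_subset_uIcc (by simp) (by simp [hc₀.le, hc₁.le])))
      (hint.mono_set (Set.uIcc_subset_uIcc (by simp [hc₀.le, hc₁.le]) (by simp)))]
  have e1 : ∫ u in (0 : ℝ)..c, ∫ v, regionKernel (middleRegion 0 1 τ c) u v
      ∂(volume.restrict (Set.Ioo (0 : ℝ) 1)) =
      ∫ u in (0 : ℝ)..c, (min 1 ((1 + τ * (1 - c) / c) * u) - max 0 (1 - τ) * u) := by
    simp only [intervalIntegral.integral_of_le hc₀.le, integral_Ioc_eq_integral_Ioo]
    exact setIntegral_congr_fun measurableSet_Ioo fun u hu =>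
      length_middleRegion_left hτ hc₀ hc₁ hu.1 hu.2
  have e2 : ∫ u in c..(1 : ℝ), ∫ v, regionKernel (middleRegion 0 1 τ c) u v
      ∂(volume.restrict (Set.Ioo (0 : ℝ) 1)) =
      ∫ u in (0 : ℝ)..(1 - c), (min 1 ((1 + τ * (1 - (1 - c)) / (1 - c)) * u)
        - max 0 (1 - τ) * u) := by
    have := intervalIntegral.integral_comp_sub_left (a := c) (b := 1)
      (fun u => min 1 ((1 + τ * (1 - (1 - c)) / (1 - c)) * u) - max 0 (1 - τ) * u) 1
    rw [sub_self] at this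
    rw [← this]
    simp only [intervalIntegral.integral_of_le hc₁.le, integral_Ioc_eq_integral_Ioo]
    exact setIntegral_congr_fun measurableSet_Ioo fun u hu =>
      length_middleRegion_right hτ hc₀ hc₁ hu.2 hu.1.le
  rw [e1, e2, integral_length_half hτ hc₀ hc₁, integral_length_half hτ (by linarith) (by linarith),
    muMiddle_eq_muOne, muOne]
  split_ifs with h
  · ring
  · have h1 : 0 < c + τ * (1 - c) := by nlinarith
    have h2 : 0 < 1 - c + τ * (1 - (1 - c)) := by nlinarith
    have h3 : c * τ - c + 1 = 1 - c + τ * (1 - (1 - c)) := by ring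
    have h4 : τ + c - c * τ = c + τ * (1 - c) := by ring
    rw [h3, h4]
    field_simp
    ring

/-! ### Assembly: mean, variance and arc count. -/

theorem Icc_one_card_succ (m : ℕ) (hm : 1 ≤ m) :
    Finset.Icc 1 (m + 1) = Finset.Icc 2 m ∪ {1, m + 1} := by
  ext i
  simp only [Finset.mem_Icc, Finset.mem_union, Finset.mem_insert, Finset.mem_singleton]
  omega

theorem sum_Icc_one_card_succ {m : ℕ} (hm : 1 ≤ m) (f : ℕ → ℝ) (a b : ℝ) :
    ∑ i ∈ Finset.Icc 1 (m + 1), f i * (if i ∈ Finset.Icc 2 m then a else b) =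
      a * ∑ i ∈ Finset.Icc 2 m, f i + b * ∑ i ∈ ({1, m + 1} : Finset ℕ), f i := by
  have hd : Disjoint (Finset.Icc 2 m) ({1, m + 1} : Finset ℕ) := by
    rw [Finset.disjoint_left]
    simp only [Finset.mem_Icc, Finset.mem_insert, Finset.mem_singleton]
    omega
  rw [Icc_one_card_succ m hm, Finset.sum_union hd, Finset.mul_sum, Finset.mul_sum]
  congr 1
  · refine Finset.sum_congr rfl fun i hi => ?_
    rw [if_pos hi, mul_comm]
  · refine Finset.sum_congr rfl fun i hi => ?_
    rw [if_neg (Finset.disjoint_right.1 hd hi), mul_comm]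

theorem regionKernel_knotParam (hδ : δ₁ < δ₂) (hY : ∀ y ∈ Y, δ₁ < y ∧ y < δ₂) (hm : 1 ≤ Y.card)
    (τ c : ℝ) : ∀ i ∈ Finset.Icc 1 (Y.card + 1), ∀ j ∈ Finset.Icc 1 (Y.card + 1),
      ∀ u ∈ Set.Ioo (0 : ℝ) 1, ∀ v ∈ Set.Ioo (0 : ℝ) 1,
      regionKernel (proximityRegion Y τ c) (knotParam δ₁ δ₂ Y i u) (knotParam δ₁ δ₂ Y j v) =
        if i = j then regionKernel (unitRegion Y τ c i) u v else 0 := by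
  intro i hi j hj u hu v hv
  have h := knotParam_mem_proximityRegion_iff (τ := τ) (c := c) hδ hY hm hi hj hu hv
  unfold regionKernel
  by_cases hij : i = j
  · by_cases hv : v ∈ unitRegion Y τ c i u
    · rw [Set.indicator_of_mem (h.2 ⟨hij, hv⟩), if_pos hij, Set.indicator_of_mem hv]
      rfl
    · rw [Set.indicator_of_notMem (fun hh => hv (h.1 hh).2), if_pos hij,
        Set.indicator_of_notMem hv]
  · rw [Set.indicator_of_notMem (fun hh => hij (h.1 hh).1), if_neg hij]

theorem ae_restrict_mem_Ioo :
    ∀ᵐ u ∂(volume.restrict (Set.Ioo (0 : ℝ) 1)), u ∈ Set.Ioo (0 : ℝ) 1 :=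
  ae_restrict_mem measurableSet_Ioo

theorem isProbabilityMeasure_cond_Ioo (hδ : δ₁ < δ₂) :
    IsProbabilityMeasure (ProbabilityTheory.cond volume (Set.Ioo δ₁ δ₂)) :=
  cond_isProbabilityMeasure_of_finite (by simpa using hδ) (by simp)

/-- The arc probability of two uniform points on `(δ₁, δ₂)` is `μ̃`. -/
theorem integral_regionKernel_eq_muTilde (hδ : δ₁ < δ₂) (hY : ∀ y ∈ Y, δ₁ < y ∧ y < δ₂)
    (hm : 1 ≤ Y.card) {τ c : ℝ} (hτ : 0 < τ) (hc₀ : 0 < c) (hc₁ : c < 1) :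
    ∫ x, ∫ y, regionKernel (proximityRegion Y τ c) x y
      ∂(ProbabilityTheory.cond volume (Set.Ioo δ₁ δ₂))
      ∂(ProbabilityTheory.cond volume (Set.Ioo δ₁ δ₂)) = muTilde δ₁ δ₂ Y τ c := by
  have hU : IsProbabilityMeasure (volume.restrict (Set.Ioo (0 : ℝ) 1)) := ⟨by simp⟩
  have := isProbabilityMeasure_cond_Ioo hδ
  rw [integral_integral_mixture (fun i => weight_nonneg hδ hY) measurable_knotParam
    (uniform_eq_mixture hδ hY) (measurable_regionKernel (measurableSet_proximityRegion Y τ c))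
    (abs_regionKernel_le _) ae_restrict_mem_Ioo (regionKernel_knotParam hδ hY hm τ c), muTilde,
    ← sum_Icc_one_card_succ hm]
  refine Finset.sum_congr rfl fun i _ => ?_
  unfold unitRegion
  split_ifs
  · rw [integral_length_middleRegion hτ hc₀ hc₁]
  · rw [integral_length_rightEndRegion hτ]

/-- Identifies the limiting variance of the U-statistic theorem: each interval enters with `w_i³`
times the second moment of its unit-interval projection. -/
theorem integral_kernelProj_sq_eq_nuTilde (hδ : δ₁ < δ₂) (hY : ∀ y ∈ Y, δ₁ < y ∧ y < δ₂)
    (hm : 1 ≤ Y.card) (τ c : ℝ) :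
    ∫ x, kernelProj (ProbabilityTheory.cond volume (Set.Ioo δ₁ δ₂))
      (regionKernel (proximityRegion Y τ c)) x ^ 2
      ∂(ProbabilityTheory.cond volume (Set.Ioo δ₁ δ₂)) - 4 * muTilde δ₁ δ₂ Y τ c ^ 2 =
      4 * nuTilde δ₁ δ₂ Y τ c := by
  have hU : IsProbabilityMeasure (volume.restrict (Set.Ioo (0 : ℝ) 1)) := ⟨by simp⟩
  have := isProbabilityMeasure_cond_Ioo hδ
  rw [integral_kernelProj_sq_mixture (fun i => weight_nonneg hδ hY) measurable_knotParam
    (uniform_eq_mixture hδ hY) (measurable_regionKernel (measurableSet_proximityRegion Y τ c))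
    (abs_regionKernel_le _) ae_restrict_mem_Ioo (regionKernel_knotParam hδ hY hm τ c), nuTilde,
    ← sum_Icc_one_card_succ hm, mul_div_cancel₀ _ (four_ne_zero)]
  congr 1
  refine Finset.sum_congr rfl fun i _ => ?_
  unfold unitRegion
  split_ifs
  · rw [integral_kernelProj_regionKernel_sq (measurableSet_middleRegion 0 1 τ c)]
  · rw [integral_kernelProj_regionKernel_sq (measurableSet_rightEndRegion 0 τ)]

/-- Turns the arc count over `Fin n` into the off-diagonal sum over `Finset.range n` of the
U-statistic, through the injection `Fin.val` on both entries. -/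
theorem ncard_arcSet (Y : Finset ℝ) (τ c : ℝ) (x : ℕ → ℝ) (n : ℕ) :
    ((arcSet Y τ c fun i : Fin n => x i).ncard : ℝ) =
      ∑ p ∈ (Finset.range n).offDiag, regionKernel (proximityRegion Y τ c) (x p.1) (x p.2) := by
  classical
  have himg : ((Finset.range n).offDiag.filter
      fun p => x p.2 ∈ proximityRegion Y τ c (x p.1) : Set (ℕ × ℕ)) =
      Prod.map Fin.val Fin.val '' (arcSet Y τ c fun i : Fin n => x i) := by
    ext ⟨i, j⟩
    simp only [Finset.coe_filter, Finset.mem_offDiag, Finset.mem_range, Set.mem_ofPred_eq,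
      Set.mem_image, arcSet, Prod.exists, Prod.map_apply, Prod.mk.injEq]
    constructor
    · rintro ⟨⟨hi, hj, hij⟩, h⟩
      exact ⟨⟨i, hi⟩, ⟨j, hj⟩, ⟨by simpa [Fin.ext_iff] using hij, h⟩, rfl, rfl⟩
    · rintro ⟨a, b, ⟨hab, h⟩, rfl, rfl⟩
      exact ⟨⟨a.2, b.2, by simpa [Fin.ext_iff] using hab⟩, h⟩
  rw [← Set.ncard_image_of_injective _ (Fin.val_injective.prodMap Fin.val_injective), ← himg,
    Set.ncard_coe_finset, Finset.card_filter, Nat.cast_sum]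
  refine Finset.sum_congr rfl fun p _ => ?_
  simp [regionKernel, Set.indicator_apply]

end CSPCD

theorem mainTheorem4 {Ω : Type*} [MeasurableSpace Ω] (P : MeasureTheory.Measure Ω)
    [MeasureTheory.IsProbabilityMeasure P]
    (δ₁ δ₂ : ℝ) (hδ : δ₁ < δ₂)
    (m : ℕ) (hm : 1 ≤ m) (Y : Finset ℝ) (hYcard : Y.card = m) (hY : ∀ y ∈ Y, δ₁ < y ∧ y < δ₂)
    (τ c : ℝ) (hτ : 0 < τ) (hc₀ : 0 < c) (hc₁ : c < 1)
    (X : ℕ → Ω → ℝ)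
    (hXindep : ProbabilityTheory.iIndepFun X P)
    (hXunif : ∀ i, MeasureTheory.pdf.IsUniform (X i) (Set.Ioo δ₁ δ₂) P MeasureTheory.volume)
    (hν : 0 < CSPCD.nuTilde δ₁ δ₂ Y τ c) :
    MeasureTheory.TendstoInDistribution
      (fun (n : ℕ) (ω : Ω) =>
        √(n : ℝ) * (CSPCD.relDensity Y τ c (fun i : Fin n => X i ω) -
          CSPCD.muTilde δ₁ δ₂ Y τ c))
      Filter.atTop (id : ℝ → ℝ) (fun _ => P)
      (ProbabilityTheory.gaussianReal 0 (Real.toNNReal (4 * CSPCD.nuTilde δ₁ δ₂ Y τ c))) := by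
  subst hYcard
  have := CSPCD.isProbabilityMeasure_cond_Ioo hδ
  -- `IsUniform` prescribes only the push-forward; a.e. measurability follows since the interval has
  -- positive finite length.
  have hlaw : ∀ i, HasLaw (X i) (ProbabilityTheory.cond volume (Set.Ioo δ₁ δ₂)) P := fun i =>
    ⟨(hXunif i).aemeasurable (by simpa using hδ) (by simp), hXunif i⟩
  have h := tendstoInDistribution_uStatistic hlaw hXindep
    (measurable_regionKernel (CSPCD.measurableSet_proximityRegion Y τ c)) (abs_regionKernel_le _)
  rw [CSPCD.integral_regionKernel_eq_muTilde hδ hY hm hτ hc₀ hc₁,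
    CSPCD.integral_kernelProj_sq_eq_nuTilde hδ hY hm τ c] at h
  have e : ∀ (n : ℕ) (ω : Ω), CSPCD.relDensity Y τ c (fun i : Fin n => X i ω) =
      (∑ p ∈ (Finset.range n).offDiag, regionKernel (CSPCD.proximityRegion Y τ c)
        (X p.1 ω) (X p.2 ω)) / ((n : ℝ) * ((n : ℝ) - 1)) := fun n ω => by
    rw [CSPCD.relDensity, CSPCD.ncard_arcSet Y τ c (fun i => X i ω)]
  simpa only [e] using h
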